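/- Let $1<\beta<2$, $z_0\in(0,1)$, $y_0\in\mathbb R$ and $\sigma^*\ge 3$ be fixed. For $n\ge 1$ consider the autoregressive model $$y_k=S(k/n)\,y_{k-1}+\xi_k,\qquad 1\le k\le n,$$ where $\xi_1,\dots,\xi_n$ are i.i.d. with a density $p$ in the class $\mathcal P$ of all probability densities on $\mathbb R$ with $\int x\,p(x)\,dx=0$, $\int x^2p(x)\,dx=1$ and $\int x^4p(x)\,dx\le\sigma^*$. Let $\mathbf E_{S,p}$ be the expectation with respect to the law of $(y_1,\dots,y_n)$. For an estimator $\widetilde S_n$, i.e. a measurable real-valued function of $(y_1,\dots,y_n)$, put $$\mathcal R_n(\widetilde S_n,S)=\sup_{p\in\mathcal P}\mathbf E_{S,p}\bigl|\widetilde S_n-S(z_0)\bigr|.$$ Let $h=n^{-1/(2\beta+1)}$ and $\varphi_n=n^{\beta/(2\beta+1)}$. For $\delta>0$ and $0<\varepsilon<1$ let $\mathcal U^{(\beta)}_{\delta,n}(z_0,\varepsilon)$ be the set of continuously differentiable $S:[0,1]\to\mathbb R$ such that $$\sup_{[0,1]}|S|\le 1-\varepsilon,\qquad \sup_{[0,1]}|\dot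 S|\le\delta^{-1},\qquad \Bigl|\int_{-1}^{1}\bigl(S(z_0+uh)-S(z_0)\bigr)\,du\Bigr|\le\delta h^{\beta}$$ (for $n$ so large that $[z_0-h,z_0+h]\subset[0,1]$; only large $n$ matter below), and put $\tau(S)=1-S^2(z_0)$. **Theorem.** For any $\delta>0$ and $0<\varepsilon<1$, $$\liminf_{n\to\infty}\ \inf_{\widetilde S_n}\ \sup_{S\in\mathcal U^{(\beta)}_{\delta,n}(z_0,\varepsilon)}\ \tau(S)^{-1/2}\,\varphi_n\,\mathcal R_n(\widetilde S_n,S)\ \ge\ \mathbf E|\eta|,$$ where $\eta$ is Gaussian with mean $0$ and variance $1/2$ and the infimum is over all estimators. -/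

import Mathlib

open MeasureTheory ProbabilityTheory Filter Set
open scoped ENNReal

noncomputable section

namespace AutoReg

/-- The class of noise densities: probability densities on the line with mean zero, variance one
and (finite) fourth moment at most `σ`. -/
structure IsNoiseDensity (σ : ℝ) (p : ℝ → ℝ) : Prop where
  measurable : Measurable p
  nonneg : ∀ x, 0 ≤ p x
  integral_eq_one : ∫ x, p x = 1
  integrable_mean : Integrable fun x => x * p x
  mean_eq_zero : ∫ x, x * p x = 0
  second_moment : ∫ x, x ^ 2 * p x = 1
  integrable_fourth : Integrable fun x => |x| ^ 4 * p x
  fourth_moment_le : ∫ x, |x| ^ 4 * p x ≤ σ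

/-- The law of the noise vector `(ξ₁, …, ξₙ)`, whose entries are i.i.d. with density `p`. The
entry `ξₖ` is the coordinate with index `k - 1` in `Fin n`. -/
def noiseLaw (n : ℕ) (p : ℝ → ℝ) : Measure (Fin n → ℝ) :=
  Measure.pi fun _ => (volume : Measure ℝ).withDensity fun x => ENNReal.ofReal (p x)

/-- The autoregressive recursion `yₖ = S (k / n) * yₖ₋₁ + ξₖ`, `1 ≤ k ≤ n`, started from `y₀`.
(The values at `k > n` are never used.) -/
def path (n : ℕ) (y₀ : ℝ) (S : ℝ → ℝ) (ξ : Fin n → ℝ) : ℕ → ℝ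
  | 0 => y₀
  | k + 1 => S (((k + 1 : ℕ) : ℝ) / (n : ℝ)) * path n y₀ S ξ k
      + (if hk : k < n then ξ ⟨k, hk⟩ else 0)

/-- The vector of observations `(y₁, …, yₙ)` as a function of the noise vector. -/
def observations (n : ℕ) (y₀ : ℝ) (S : ℝ → ℝ) (ξ : Fin n → ℝ) : Fin n → ℝ :=
  fun k => path n y₀ S ξ (k + 1)

theorem measurable_observations (n : ℕ) (y₀ : ℝ) (S : ℝ → ℝ) :
    Measurable (observations n y₀ S) := by
  have h : ∀ k : ℕ, Measurable fun ξ : Fin n → ℝ => path n y₀ S ξ k := by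
    intro k
    induction k with
    | zero => exact measurable_const
    | succ k ih =>
      by_cases hk : k < n
      · simp only [path, hk, dif_pos]
        exact (ih.const_mul _).add (measurable_pi_apply _)
      · simp only [path, hk, dif_neg, not_false_eq_true]
        exact (ih.const_mul _).add measurable_const
  exact measurable_pi_lambda _ fun k => h _

/-- The distribution of the observations `(y₁, …, yₙ)` for the coefficient function `S` and the
noise density `p`. -/
def obsLaw (n : ℕ) (y₀ : ℝ) (S p : ℝ → ℝ) : Measure (Fin n → ℝ) :=
  (noiseLaw n p).map (observations n y₀ S)

/-- The risk at the point `z₀` of the estimator `T`: the supremum over the noise densities of the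
expected absolute error, as an extended nonnegative real. -/
def risk (n : ℕ) (y₀ σ z₀ : ℝ) (T : (Fin n → ℝ) → ℝ) (S : ℝ → ℝ) : ℝ≥0∞ :=
  ⨆ (p : ℝ → ℝ) (_ : IsNoiseDensity σ p),
    ∫⁻ y, ENNReal.ofReal |T y - S z₀| ∂(obsLaw n y₀ S p)

/-- The stability set: continuously differentiable functions on `[0, 1]` bounded by `1 - ε` there.
Such a function is represented by a function on the line, of which only the values on `[0, 1]` are
constrained. -/
def stabilitySet (ε : ℝ) : Set (ℝ → ℝ) :=
  {S | ContDiffOn ℝ 1 S (Icc 0 1) ∧ ∀ x ∈ Icc (0 : ℝ) 1, |S x| ≤ 1 - ε}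

/-- The bandwidth `n ^ (-1 / (2 β + 1))`. -/
def bandwidth (β : ℝ) (n : ℕ) : ℝ := (n : ℝ) ^ (-1 / (2 * β + 1))

/-- The normalizing sequence `n ^ (β / (2 β + 1))`. -/
def rate (β : ℝ) (n : ℕ) : ℝ := (n : ℝ) ^ (β / (2 * β + 1))

/-- The averaged increment of `S` around `z₀` at scale `h`. -/
def avgIncrement (h z₀ : ℝ) (S : ℝ → ℝ) : ℝ :=
  ∫ u in (-1 : ℝ)..1, (S (z₀ + u * h) - S z₀)

/-- The weak stable local Hölder class at `z₀`. -/
def weakHolderClass (β δ : ℝ) (n : ℕ) (z₀ ε : ℝ) : Set (ℝ → ℝ) :=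
  {S | S ∈ stabilitySet ε ∧ (∀ x ∈ Icc (0 : ℝ) 1, |derivWithin S (Icc 0 1) x| ≤ δ⁻¹) ∧
    |avgIncrement (bandwidth β n) z₀ S| ≤ δ * bandwidth β n ^ β}

/-- `τ(S) = 1 - S(z₀)²`. -/
def tau (z₀ : ℝ) (S : ℝ → ℝ) : ℝ := 1 - S z₀ ^ 2

/-- The minimax risk over the weak class, normalized by `τ(S) ^ (-1/2)` and by the rate; the
infimum is over all measurable functions of the observations. -/
def normalizedMinimaxRisk (β δ y₀ σ z₀ ε : ℝ) (n : ℕ) : ℝ≥0∞ :=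
  ⨅ (T : (Fin n → ℝ) → ℝ) (_ : Measurable T), ⨆ S ∈ weakHolderClass β δ n z₀ ε,
    ENNReal.ofReal (tau z₀ S ^ (-1 / 2 : ℝ)) * ENNReal.ofReal (rate β n) * risk n y₀ σ z₀ T S

end AutoReg

end

/-!
It suffices to bound the risk for standard Gaussian noise over the one-parameter family
`S = u • g`, `|u| ≤ b`, where `g x = ψ V ((x - z₀) / h)` with `ψ = h ^ β` and `V` a smooth plateau
with `V 0 = 1`, close to the indicator of `[-1, 1]`. These functions lie in the weak Hölder class
(`smul_perturbation_mem`): the averaged increment only sees `∫ (V - 1)`, which is as small as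
desired. Moreover `S z₀ = u ψ`, `τ(S) ≤ 1`, and `ψ` is the inverse of the rate, so the normalized
loss of `T` is at least `|T / ψ - u|`.

The observations are a volume preserving triangular transformation of the noise, whence the
likelihood ratio against `u = 0` is exactly `exp (u s - u² I / 2)` with a score `s` and an observed
information `I` (`obsLaw_smul`). Under every `u` in the range, `I` is close to `ψ²` times the number
of design points in the window, that is to `2` (`weighted_sum_concentration`,
`sum_sq_coeff_perturbation`); this is the source of the variance `1 / 2`.

The risk is bounded through the uniform prior on `[-b, b]`, without a central limit theorem.
The posterior is proportional to a Gaussian density with centre `s / I` and precision `I`.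
Restricting it to the parameters within `r` of its centre makes it symmetric, so that no estimate
beats the centre, and gives conditional loss at least
`√(2 / (π K)) (1 - exp (-r² / 2))` when `1 ≤ I ≤ K` (`posterior_loss_ge`). The remaining mass is
that of the data with `|s - u I| > r I`. Changing the parameter from `u` to `u ± r` multiplies the
likelihood there by at least `exp (r² / 2)`, so that this mass is at most `2 exp (-r² / 2)`
(`tail_mass_le`). With `b = r²` and `K = 2 + 1 / r`, letting `n → ∞` and then `r → ∞` gives
`1 / √π`, which is the mean of `|η|`.
-/

noncomputable section

namespace AutoReg

/-! ### Moments of the standard Gaussian density -/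

theorem gaussianPDFReal_zero_one (x : ℝ) :
    gaussianPDFReal 0 1 x = (√(2 * Real.pi))⁻¹ * Real.exp (-(1 / 2) * x ^ 2) := by
  rw [gaussianPDFReal_def]
  norm_num
  left; ring

theorem withDensity_gaussianPDFReal :
    (volume.withDensity fun x => ENNReal.ofReal (gaussianPDFReal 0 1 x)) = gaussianReal 0 1 :=
  (gaussianReal_of_var_ne_zero 0 one_ne_zero).symm

theorem integrable_pow_gaussianReal (k : ℕ) :
    Integrable (fun x : ℝ => x ^ k) (gaussianReal 0 1) := by
  have h := (memLp_id_gaussianReal (μ := 0) (v := 1) (k : NNReal))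
  rcases Nat.eq_zero_or_pos k with rfl | hk
  · simp
  · have h2 := h.integrable_norm_rpow (by simpa using hk.ne') (by simp)
    refine (integrable_norm_iff (by fun_prop)).1 ?_
    refine h2.congr (ae_of_all _ fun x => ?_)
    simp

theorem integral_gaussianReal_zero_one (f : ℝ → ℝ) :
    ∫ x, f x ∂gaussianReal 0 1 = ∫ x, f x * gaussianPDFReal 0 1 x := by
  rw [integral_gaussianReal_eq_integral_smul one_ne_zero]
  simp only [smul_eq_mul, mul_comm]

theorem integrable_mul_gaussianPDFReal {f : ℝ → ℝ} (hf : Integrable f (gaussianReal 0 1)) :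
    Integrable fun x => f x * gaussianPDFReal 0 1 x := by
  rw [← withDensity_gaussianPDFReal, integrable_withDensity_iff
    (measurable_gaussianPDFReal 0 1).ennreal_ofReal (ae_of_all _ fun x => ENNReal.ofReal_lt_top)]
    at hf
  refine hf.congr (ae_of_all _ fun x => ?_)
  simp only
  rw [ENNReal.toReal_ofReal (gaussianPDFReal_nonneg 0 1 x)]

theorem integral_sq_gaussianReal : ∫ x, x ^ 2 ∂gaussianReal 0 1 = 1 := by
  have h := variance_fun_id_gaussianReal (μ := 0) (v := 1)
  rw [variance_eq_integral (by fun_prop)] at h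
  simpa using h

theorem integral_pow_four_gaussianReal : ∫ x, x ^ 4 ∂gaussianReal 0 1 = 3 := by
  rw [integral_gaussianReal_zero_one]
  simp only [gaussianPDFReal_zero_one]
  have h1 : ∀ x : ℝ, x ^ 4 * ((√(2 * Real.pi))⁻¹ * Real.exp (-(1 / 2) * x ^ 2)) =
      (fun t : ℝ => (√(2 * Real.pi))⁻¹ * (t ^ (4 : ℝ) * Real.exp (-(1 / 2) * t ^ (2 : ℝ)))) |x| := by
    intro x
    simp only [Real.rpow_ofNat]
    rw [Even.pow_abs (by decide), sq_abs]
    ring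
  simp only [h1]
  rw [integral_comp_abs (f := fun t : ℝ =>
    (√(2 * Real.pi))⁻¹ * (t ^ (4 : ℝ) * Real.exp (-(1 / 2) * t ^ (2 : ℝ)))), integral_const_mul,
    integral_rpow_mul_exp_neg_mul_rpow (by norm_num) (by norm_num) (by norm_num)]
  have h2 : Real.Gamma ((4 + 1) / 2) = 3 / 4 * √Real.pi := by
    rw [show ((4 : ℝ) + 1) / 2 = (1 / 2 + 1) + 1 by norm_num, Real.Gamma_add_one (by norm_num),
      Real.Gamma_add_one (by norm_num), Real.Gamma_one_half_eq]
    ring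
  have h3 : ((1 / 2 : ℝ)) ^ (-(4 + 1) / 2 : ℝ) = 4 * √2 := by
    rw [one_div, Real.inv_rpow (by norm_num), ← Real.rpow_neg (by norm_num),
      show (-(-(4 + 1) / 2) : ℝ) = 2 + 1 / 2 by norm_num, Real.rpow_add (by norm_num),
      ← Real.sqrt_eq_rpow]
    norm_num
  rw [h2, h3, Real.sqrt_mul (by norm_num)]
  have := Real.sqrt_pos.2 Real.pi_pos
  field_simp

/-- The standard Gaussian density is admissible: its fourth moment is `3`. -/
theorem isNoiseDensity_gaussian {σ : ℝ} (hσ : 3 ≤ σ) :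
    IsNoiseDensity σ (gaussianPDFReal 0 1) where
  measurable := measurable_gaussianPDFReal 0 1
  nonneg := gaussianPDFReal_nonneg 0 1
  integral_eq_one := integral_gaussianPDFReal_eq_one 0 one_ne_zero
  integrable_mean := integrable_mul_gaussianPDFReal (by simpa using integrable_pow_gaussianReal 1)
  mean_eq_zero := by
    rw [← integral_gaussianReal_zero_one fun x => x, integral_id_gaussianReal]
  second_moment := by
    rw [← integral_gaussianReal_zero_one fun x => x ^ 2, integral_sq_gaussianReal]
  integrable_fourth := by
    simp only [Even.pow_abs (show Even 4 by decide)]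
    exact integrable_mul_gaussianPDFReal (integrable_pow_gaussianReal 4)
  fourth_moment_le := by
    simp only [Even.pow_abs (show Even 4 by decide)]
    rwa [← integral_gaussianReal_zero_one fun x => x ^ 4, integral_pow_four_gaussianReal]

/-- The right-hand side of the minimax bound in closed form. -/
theorem integral_abs_gaussianReal_half :
    ∫ x, |x| ∂gaussianReal 0 (1 / 2) = (√Real.pi)⁻¹ := by
  rw [integral_gaussianReal_eq_integral_smul (by norm_num)]
  simp only [smul_eq_mul, gaussianPDFReal_def]
  have h1 : ∀ x : ℝ, (√(2 * Real.pi * ((1 / 2 : NNReal) : ℝ)))⁻¹ *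
      Real.exp (-(x - 0) ^ 2 / (2 * ((1 / 2 : NNReal) : ℝ))) * |x| =
      (fun t : ℝ => (√Real.pi)⁻¹ * (t ^ (1 : ℝ) * Real.exp (-1 * t ^ (2 : ℝ)))) |x| := by
    intro x
    simp only [Real.rpow_ofNat, Real.rpow_one, sq_abs]
    rw [show 2 * Real.pi * ((1 / 2 : NNReal) : ℝ) = Real.pi by push_cast; ring,
      show -(x - 0) ^ 2 / (2 * ((1 / 2 : NNReal) : ℝ)) = -1 * x ^ 2 by push_cast; ring]
    ring
  simp only [h1]
  rw [integral_comp_abs (f := fun t : ℝ =>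
    (√Real.pi)⁻¹ * (t ^ (1 : ℝ) * Real.exp (-1 * t ^ (2 : ℝ)))), integral_const_mul,
    integral_rpow_mul_exp_neg_mul_rpow (by norm_num) (by norm_num) (by norm_num)]
  norm_num
  ring

/-! ### The likelihood of the Gaussian autoregression -/

/-- A finite product of copies of a measure with integrable density has the product density. -/
theorem pi_withDensity_ofReal {ι : Type*} [Fintype ι] {f : ℝ → ℝ} (hf : Integrable f)
    (hf₀ : ∀ x, 0 ≤ f x) :
    Measure.pi (fun _ : ι => volume.withDensity fun x => ENNReal.ofReal (f x)) =
      (volume : Measure (ι → ℝ)).withDensity fun x => ENNReal.ofReal (∏ i, f (x i)) := by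
  have : IsFiniteMeasure (volume.withDensity fun x => ENNReal.ofReal (f x)) :=
    isFiniteMeasure_withDensity_ofReal hf.2
  refine Measure.pi_eq fun s hs => ?_
  rw [withDensity_apply _ (MeasurableSet.univ_pi hs), volume_pi, Measure.restrict_pi_pi,
    ← ofReal_integral_eq_lintegral_ofReal
      (Integrable.fintype_prod (f := fun _ => f) fun i => hf.restrict)
      (ae_of_all _ fun x => Finset.prod_nonneg fun i _ => hf₀ _),
    integral_fintype_prod_eq_prod (fun _ => f),
    ENNReal.ofReal_prod_of_nonneg fun i _ => integral_nonneg hf₀]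
  refine Finset.prod_congr rfl fun i _ => ?_
  rw [withDensity_apply _ (hs i),
    ofReal_integral_eq_lintegral_ofReal hf.restrict (ae_of_all _ hf₀)]

/-- The sequence of states `y₀, y₁, …, yₙ` (extended by zero) recovered from the vector of
observations `(y₁, …, yₙ)`. The regressor of the coordinate `k : Fin n` is `lag y₀ y k`. -/
def lag {n : ℕ} (y₀ : ℝ) (y : Fin n → ℝ) : ℕ → ℝ
  | 0 => y₀
  | j + 1 => if h : j < n then y ⟨j, h⟩ else 0

/-- The autoregressive coefficient `S ((k + 1) / n)` acting on the coordinate `k`. -/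
def coeff (n : ℕ) (S : ℝ → ℝ) (k : ℕ) : ℝ := S (((k + 1 : ℕ) : ℝ) / (n : ℝ))

/-- The noise vector recovered from the observations, `ξₖ = yₖ - S (k / n) yₖ₋₁`. -/
def innovations {n : ℕ} (y₀ : ℝ) (S : ℝ → ℝ) (y : Fin n → ℝ) : Fin n → ℝ :=
  fun k => y k - coeff n S k * lag y₀ y k

theorem measurable_lag {n : ℕ} (y₀ : ℝ) (k : ℕ) :
    Measurable fun y : Fin n → ℝ => lag y₀ y k := by
  cases k with
  | zero => exact measurable_const
  | succ j =>
    by_cases h : j < n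
    · simp only [lag, h, dif_pos]
      exact measurable_pi_apply _
    · simp only [lag, h, dif_neg, not_false_eq_true]
      exact measurable_const

theorem path_succ {n : ℕ} (y₀ : ℝ) (S : ℝ → ℝ) (ξ : Fin n → ℝ) {k : ℕ} (hk : k < n) :
    path n y₀ S ξ (k + 1) = coeff n S k * path n y₀ S ξ k + ξ ⟨k, hk⟩ := by
  simp [path, coeff, hk]

theorem lag_observations {n : ℕ} (y₀ : ℝ) (S : ℝ → ℝ) (ξ : Fin n → ℝ) {k : ℕ} (hk : k ≤ n) :
    lag y₀ (observations n y₀ S ξ) k = path n y₀ S ξ k := by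
  cases k with
  | zero => rfl
  | succ j => simp [lag, observations, Nat.lt_of_succ_le hk]

theorem observations_innovations {n : ℕ} (y₀ : ℝ) (S : ℝ → ℝ) (y : Fin n → ℝ) :
    observations n y₀ S (innovations y₀ S y) = y := by
  have h : ∀ k ≤ n, path n y₀ S (innovations y₀ S y) k = lag y₀ y k := by
    intro k
    induction k with
    | zero => intro _; rfl
    | succ k ih =>
      intro hk
      have hk' : k < n := hk
      rw [path_succ y₀ S _ hk', ih hk'.le]
      simp [innovations, lag, hk']
  ext k
  rw [observations, h _ k.2]
  simp [lag]

/-- The linear part of the innovation map. -/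
def innovationsLinear {n : ℕ} (S : ℝ → ℝ) : (Fin n → ℝ) →ₗ[ℝ] (Fin n → ℝ) where
  toFun y := innovations 0 S y
  map_add' x y := by
    ext k
    rcases k with ⟨_ | j, hk⟩
    · simp [innovations, lag]
    · simp [innovations, lag, Nat.lt_of_succ_lt hk]; ring
  map_smul' c y := by
    ext k
    rcases k with ⟨_ | j, hk⟩
    · simp [innovations, lag]
    · simp [innovations, lag, Nat.lt_of_succ_lt hk]; ring

theorem det_innovationsLinear {n : ℕ} (S : ℝ → ℝ) :
    LinearMap.det (innovationsLinear (n := n) S) = 1 := by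
  rw [← LinearMap.det_toMatrix', Matrix.det_of_isLowerTriangular]
  · refine Finset.prod_eq_one fun i _ => ?_
    rcases i with ⟨_ | j, hk⟩
    · simp [LinearMap.toMatrix'_apply, innovationsLinear, innovations, lag]
    · simp [LinearMap.toMatrix'_apply, innovationsLinear, innovations, lag]
  · intro i j hij
    rcases i with ⟨_ | i, hi⟩ <;> rcases j with ⟨j, hj⟩
    · have : j ≠ 0 := by
        rintro rfl
        simp at hij
      simp [LinearMap.toMatrix'_apply, innovationsLinear, innovations, lag, this.symm]
    · have h1 : i + 1 < j := by simpa using hij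
      have h2 : i + 1 ≠ j := by omega
      have h3 : i ≠ j := by omega
      simp [LinearMap.toMatrix'_apply, innovationsLinear, innovations, lag, h2, h3]

theorem measurable_innovations {n : ℕ} (y₀ : ℝ) (S : ℝ → ℝ) :
    Measurable (innovations (n := n) y₀ S) :=
  measurable_pi_lambda _ fun k => (measurable_pi_apply k).sub ((measurable_lag y₀ k).const_mul _)

/-- The innovation map is affine with a unipotent lower triangular linear part, hence preserves
Lebesgue measure. -/
theorem measurePreserving_innovations {n : ℕ} (y₀ : ℝ) (S : ℝ → ℝ) :
    MeasurePreserving (innovations (n := n) y₀ S) volume volume := by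
  have h1 : MeasurePreserving (innovationsLinear (n := n) S) volume volume := by
    refine ⟨(measurable_innovations 0 S), ?_⟩
    rw [Real.map_linearMap_volume_pi_eq_smul_volume_pi (by simp [det_innovationsLinear]),
      det_innovationsLinear]
    simp
  have h2 := (measurePreserving_sub_right volume
    (fun k : Fin n => coeff n S k * if (k : ℕ) = 0 then y₀ else 0)).comp h1
  have h3 : innovations (n := n) y₀ S =
      (fun y => y - fun k : Fin n => coeff n S k * if (k : ℕ) = 0 then y₀ else 0) ∘
        innovationsLinear S := by
    ext y k
    rcases k with ⟨_ | j, hk⟩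
    · simp [innovationsLinear, innovations, lag]
    · simp [innovationsLinear, innovations, lag]
  rwa [h3]

/-- The log-likelihood ratio of the Gaussian autoregression with coefficient `S` against pure
noise. -/
def logLikelihood {n : ℕ} (y₀ : ℝ) (S : ℝ → ℝ) (y : Fin n → ℝ) : ℝ :=
  ∑ k : Fin n, (coeff n S k * lag y₀ y k * y k - (coeff n S k * lag y₀ y k) ^ 2 / 2)

theorem measurable_logLikelihood {n : ℕ} (y₀ : ℝ) (S : ℝ → ℝ) :
    Measurable (logLikelihood (n := n) y₀ S) := by
  unfold logLikelihood
  have := fun k => measurable_lag (n := n) y₀ k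
  fun_prop

theorem prod_gaussianPDFReal_innovations {n : ℕ} (y₀ : ℝ) (S : ℝ → ℝ) (y : Fin n → ℝ) :
    ∏ k, gaussianPDFReal 0 1 (innovations y₀ S y k) =
      (∏ k, gaussianPDFReal 0 1 (y k)) * Real.exp (logLikelihood y₀ S y) := by
  rw [logLikelihood, Real.exp_sum, ← Finset.prod_mul_distrib]
  refine Finset.prod_congr rfl fun k _ => ?_
  rw [gaussianPDFReal_zero_one, gaussianPDFReal_zero_one, mul_assoc, ← Real.exp_add]
  congr 2
  simp only [innovations]
  ring

theorem noiseLaw_gaussian (n : ℕ) :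
    noiseLaw n (gaussianPDFReal 0 1) = Measure.pi fun _ => gaussianReal 0 1 := by
  rw [noiseLaw, withDensity_gaussianPDFReal]

/-- The Gaussian autoregression has an explicit likelihood ratio against pure noise. -/
theorem obsLaw_gaussian (n : ℕ) (y₀ : ℝ) (S : ℝ → ℝ) :
    obsLaw n y₀ S (gaussianPDFReal 0 1) = (noiseLaw n (gaussianPDFReal 0 1)).withDensity
      fun y => ENNReal.ofReal (Real.exp (logLikelihood y₀ S y)) := by
  have hpi : noiseLaw n (gaussianPDFReal 0 1) = (volume : Measure (Fin n → ℝ)).withDensity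
      fun x => ENNReal.ofReal (∏ i, gaussianPDFReal 0 1 (x i)) :=
    pi_withDensity_ofReal (integrable_gaussianPDFReal 0 1) (gaussianPDFReal_nonneg 0 1)
  have hm := measurable_gaussianPDFReal 0 1
  have hF : Measurable fun x : Fin n → ℝ => ENNReal.ofReal (∏ i, gaussianPDFReal 0 1 (x i)) := by
    fun_prop
  have hL : Measurable fun y : Fin n → ℝ =>
      ENNReal.ofReal (Real.exp (logLikelihood y₀ S y)) :=
    (measurable_logLikelihood y₀ S).exp.ennreal_ofReal
  rw [obsLaw, hpi, ← withDensity_mul _ hF hL]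
  ext s hs
  have hs' := measurable_observations n y₀ S hs
  rw [Measure.map_apply (measurable_observations n y₀ S) hs, withDensity_apply _ hs',
    withDensity_apply _ hs, ← lintegral_indicator hs', ← lintegral_indicator hs,
    ← (measurePreserving_innovations y₀ S).lintegral_comp (hF.indicator hs')]
  refine lintegral_congr fun y => ?_
  simp only [indicator, Pi.mul_apply]
  rw [prod_gaussianPDFReal_innovations,
    ENNReal.ofReal_mul (Finset.prod_nonneg fun i _ => gaussianPDFReal_nonneg 0 1 _)]
  have hmem : innovations y₀ S y ∈ observations n y₀ S ⁻¹' s ↔ y ∈ s := by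
    rw [mem_preimage, observations_innovations]
  by_cases hy : y ∈ s <;> simp [hy, hmem]

/-! ### A Bayes bound for quadratic log-likelihoods -/

theorem integral_mul_exp_neg_sq {a : ℝ} (ha : 0 < a) (r : ℝ) :
    ∫ v in (0 : ℝ)..r, 2 * v * Real.exp (-(a / 2) * v ^ 2) =
      2 / a * (1 - Real.exp (-(a / 2) * r ^ 2)) := by
  have h : ∀ v ∈ uIcc (0 : ℝ) r, HasDerivAt (fun v => -(2 / a) * Real.exp (-(a / 2) * v ^ 2))
      (2 * v * Real.exp (-(a / 2) * v ^ 2)) v := by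
    intro v _
    have h1 := (((hasDerivAt_pow 2 v).const_mul (-(a / 2))).exp).const_mul (-(2 / a))
    refine h1.congr_deriv ?_
    field_simp
    push_cast
    ring
  rw [intervalIntegral.integral_eq_sub_of_hasDerivAt h
    (Continuous.intervalIntegrable (by fun_prop) _ _)]
  simp
  ring

/-- Among all centres `t`, the truncated absolute loss against a symmetric weight is smallest at
`t = 0`, because `|t - v| + |t + v| ≥ 2 |v|`. -/
theorem truncated_abs_loss_ge {a : ℝ} (ha : 0 < a) {r : ℝ} (hr : 0 ≤ r) (t : ℝ) :
    2 / a * (1 - Real.exp (-(a / 2) * r ^ 2)) ≤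
      ∫ v in -r..r, |t - v| * Real.exp (-(a / 2) * v ^ 2) := by
  set f : ℝ → ℝ := fun v => |t - v| * Real.exp (-(a / 2) * v ^ 2) with hf
  have hfc : Continuous f := by fun_prop
  have hi : ∀ x y, IntervalIntegrable f volume x y := fun x y => hfc.intervalIntegrable x y
  have h1 : ∫ v in -r..r, f v = ∫ v in (0 : ℝ)..r, (f v + f (-v)) := by
    rw [← intervalIntegral.integral_add_adjacent_intervals (hi (-r) 0) (hi 0 r),
      intervalIntegral.integral_add (g := fun v => f (-v)) (hi _ _)
        ((hfc.comp continuous_neg).intervalIntegrable _ _), intervalIntegral.integral_comp_neg,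
      neg_zero, add_comm]
  rw [h1, ← integral_mul_exp_neg_sq ha]
  refine intervalIntegral.integral_mono_on hr (Continuous.intervalIntegrable (by fun_prop) _ _)
    (Continuous.intervalIntegrable (by fun_prop) _ _) fun v hv => ?_
  simp only [hf, neg_sq, ← add_mul]
  refine mul_le_mul_of_nonneg_right ?_ (Real.exp_pos _).le
  have h2 := neg_abs_le (t - v)
  have h3 := le_abs_self (t - -v)
  linarith

theorem truncated_mass_le {a : ℝ} (ha : 0 < a) {r : ℝ} (hr : 0 ≤ r) :
    ∫ v in -r..r, Real.exp (-(a / 2) * v ^ 2) ≤ √(2 * Real.pi / a) := by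
  have h := integral_gaussian (a / 2)
  rw [show Real.pi / (a / 2) = 2 * Real.pi / a by field_simp] at h
  rw [← h, intervalIntegral.integral_of_le (by linarith)]
  exact setIntegral_le_integral (integrable_exp_neg_mul_sq (by linarith))
    (ae_of_all _ fun v => (Real.exp_pos _).le)

/-- The lower bound for the mean absolute deviation of a Gaussian posterior truncated to radius `r`,
when its precision lies in `[1, K]`. -/
def posteriorLoss (K r : ℝ) : ℝ := √(2 / (Real.pi * K)) * (1 - Real.exp (-r ^ 2 / 2))

theorem posteriorLoss_nonneg (K r : ℝ) : 0 ≤ posteriorLoss K r := by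
  refine mul_nonneg (Real.sqrt_nonneg _) (sub_nonneg.2 (Real.exp_le_one_iff.2 ?_))
  nlinarith [sq_nonneg r]

theorem posteriorLoss_mul_mass_le {a K r : ℝ} (ha : 1 ≤ a) (haK : a ≤ K) (hr : 0 ≤ r) (t : ℝ) :
    posteriorLoss K r * ∫ v in -r..r, Real.exp (-(a / 2) * v ^ 2) ≤
      ∫ v in -r..r, |t - v| * Real.exp (-(a / 2) * v ^ 2) := by
  have ha0 : 0 < a := by linarith
  have hpi := Real.pi_pos
  have h1 : Real.exp (-(a / 2) * r ^ 2) ≤ Real.exp (-r ^ 2 / 2) :=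
    Real.exp_le_exp.2 (by nlinarith [sq_nonneg r])
  have hK : 0 < K := by linarith
  have h2 : √(2 / (Real.pi * K)) * √(2 * Real.pi / a) ≤ 2 / a := by
    rw [← Real.sqrt_mul (by positivity)]
    refine Real.sqrt_le_iff.2 ⟨by positivity, ?_⟩
    rw [show 2 / (Real.pi * K) * (2 * Real.pi / a) = 4 / (K * a) by field_simp; norm_num,
      show (2 / a) ^ 2 = 4 / (a * a) by ring]
    gcongr
  have h3 : 0 ≤ 1 - Real.exp (-r ^ 2 / 2) :=
    sub_nonneg.2 (Real.exp_le_one_iff.2 (by nlinarith [sq_nonneg r]))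
  calc posteriorLoss K r * ∫ v in -r..r, Real.exp (-(a / 2) * v ^ 2)
      ≤ posteriorLoss K r * √(2 * Real.pi / a) :=
        mul_le_mul_of_nonneg_left (truncated_mass_le ha0 hr) (posteriorLoss_nonneg K r)
    _ = √(2 / (Real.pi * K)) * √(2 * Real.pi / a) * (1 - Real.exp (-r ^ 2 / 2)) := by
        rw [posteriorLoss]; ring
    _ ≤ 2 / a * (1 - Real.exp (-(a / 2) * r ^ 2)) := by gcongr
    _ ≤ _ := truncated_abs_loss_ge ha0 hr t

/-- The quadratic likelihood ratio with score `s` and information `a`, at the parameter `u`. -/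
def quadLik (s a u : ℝ) : ℝ := Real.exp (u * s - u ^ 2 * a / 2)

theorem quadLik_eq {s a : ℝ} (ha : 0 < a) (u : ℝ) :
    quadLik s a u = Real.exp (s ^ 2 / (2 * a)) * Real.exp (-(a / 2) * (u - s / a) ^ 2) := by
  rw [quadLik, ← Real.exp_add]
  congr 1
  field_simp
  ring

theorem lintegral_Icc_ofReal {f : ℝ → ℝ} (hf : Continuous f) (hf₀ : ∀ x, 0 ≤ f x) {x y : ℝ}
    (hxy : x ≤ y) :
    ∫⁻ u in Icc x y, ENNReal.ofReal (f u) = ENNReal.ofReal (∫ u in x..y, f u) := by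
  rw [intervalIntegral.integral_of_le hxy, ← integral_Icc_eq_integral_Ioc,
    ofReal_integral_eq_lintegral_ofReal hf.integrableOn_Icc (ae_of_all _ hf₀)]

/-- The posterior for the uniform prior on `[-b, b]` under a quadratic log-likelihood, restricted
to the parameters within `r` of the posterior centre `s / a`, is a symmetric truncated Gaussian as
soon as that neighbourhood fits into `[-b, b]`; if it does not, no parameter of
`[-(b - 2r), b - 2r]` is within `r` of the centre. -/
theorem posterior_loss_ge {a K r b : ℝ} (ha : 1 ≤ a) (haK : a ≤ K) (hr : 0 ≤ r) (s t : ℝ) :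
    ENNReal.ofReal (posteriorLoss K r) * ∫⁻ u in Icc (-(b - 2 * r)) (b - 2 * r),
        {u | |s - u * a| ≤ r * a}.indicator (fun u => ENNReal.ofReal (quadLik s a u)) u ≤
      ∫⁻ u in Icc (-b) b, ENNReal.ofReal |t - u| * ENNReal.ofReal (quadLik s a u) := by
  have ha0 : 0 < a := by linarith
  set m := s / a with hm
  have hset : ∀ u, |s - u * a| ≤ r * a ↔ u ∈ Icc (m - r) (m + r) := by
    intro u
    rw [show s - u * a = (m - u) * a by rw [hm]; field_simp, abs_mul, abs_of_pos ha0,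
      mul_le_mul_iff_left₀ ha0, abs_le, mem_Icc]
    constructor <;> rintro ⟨h1, h2⟩ <;> constructor <;> linarith
  have hcl : Continuous fun u => quadLik s a u := by unfold quadLik; fun_prop
  by_cases hmb : |m| ≤ b - r
  · have hb1 : Icc (m - r) (m + r) ⊆ Icc (-b) b := by
      rw [abs_le] at hmb
      exact Icc_subset_Icc (by linarith) (by linarith)
    have hset' : {u | |s - u * a| ≤ r * a} = Icc (m - r) (m + r) := by
      ext u; exact hset u
    have hshift : ∀ F : ℝ → ℝ, ∫ u in (m - r)..(m + r), F (u - m) = ∫ v in -r..r, F v := by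
      intro F
      rw [intervalIntegral.integral_comp_sub_right]
      congr 1 <;> ring
    have e1 : ∫ u in (m - r)..(m + r), quadLik s a u =
        Real.exp (s ^ 2 / (2 * a)) * ∫ v in -r..r, Real.exp (-(a / 2) * v ^ 2) := by
      rw [← hshift fun v => Real.exp (-(a / 2) * v ^ 2), ← intervalIntegral.integral_const_mul]
      simp only [quadLik_eq ha0, hm]
    have e2 : ∫ u in (m - r)..(m + r), |t - u| * quadLik s a u = Real.exp (s ^ 2 / (2 * a)) *
        ∫ v in -r..r, |(t - m) - v| * Real.exp (-(a / 2) * v ^ 2) := by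
      rw [← hshift fun v => |(t - m) - v| * Real.exp (-(a / 2) * v ^ 2),
        ← intervalIntegral.integral_const_mul]
      simp only [quadLik_eq ha0, sub_sub_sub_cancel_right]
      refine intervalIntegral.integral_congr fun u _ => ?_
      simp only [hm]
      ring
    calc ENNReal.ofReal (posteriorLoss K r) * ∫⁻ u in Icc (-(b - 2 * r)) (b - 2 * r),
          {u | |s - u * a| ≤ r * a}.indicator (fun u => ENNReal.ofReal (quadLik s a u)) u
        ≤ ENNReal.ofReal (posteriorLoss K r) *
          ∫⁻ u in Icc (m - r) (m + r), ENNReal.ofReal (quadLik s a u) := by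
          refine mul_le_mul_right ?_ _
          rw [hset', ← lintegral_indicator (s := Icc (m - r) (m + r)) measurableSet_Icc]
          exact setLIntegral_le_lintegral _ _
      _ = ENNReal.ofReal (posteriorLoss K r * ∫ u in (m - r)..(m + r), quadLik s a u) := by
          rw [lintegral_Icc_ofReal hcl (fun u => (Real.exp_pos _).le) (by linarith),
            ENNReal.ofReal_mul (posteriorLoss_nonneg K r)]
      _ ≤ ENNReal.ofReal (∫ u in (m - r)..(m + r), |t - u| * quadLik s a u) := by
          refine ENNReal.ofReal_le_ofReal ?_
          rw [e1, e2, mul_left_comm]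
          exact mul_le_mul_of_nonneg_left (posteriorLoss_mul_mass_le ha haK hr _)
            (Real.exp_pos _).le
      _ = ∫⁻ u in Icc (m - r) (m + r), ENNReal.ofReal (|t - u| * quadLik s a u) :=
          (lintegral_Icc_ofReal (by fun_prop)
            (fun u => mul_nonneg (abs_nonneg _) (Real.exp_pos _).le) (by linarith)).symm
      _ = ∫⁻ u in Icc (m - r) (m + r),
            ENNReal.ofReal |t - u| * ENNReal.ofReal (quadLik s a u) := by
          simp only [ENNReal.ofReal_mul (abs_nonneg _)]
      _ ≤ _ := lintegral_mono_set hb1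
  -- Here no admissible `u` lies within `r` of the centre, so the left side vanishes.
  · have : ∫⁻ u in Icc (-(b - 2 * r)) (b - 2 * r),
        {u | |s - u * a| ≤ r * a}.indicator (fun u => ENNReal.ofReal (quadLik s a u)) u = 0 := by
      refine (setLIntegral_congr_fun measurableSet_Icc fun u hu => ?_).trans lintegral_zero
      refine indicator_of_notMem (fun hu' => hmb ?_) _
      have h1 := (hset u).1 hu'
      rw [abs_le]
      constructor <;> linarith [h1.1, h1.2, hu.1, hu.2]
    rw [this, mul_zero]
    exact zero_le

section Bayes

variable {Ω : Type*} [MeasurableSpace Ω]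

/-- The data for which the information lies in `[1, K]` and the parameter `u` is within `r` of the
posterior centre. -/
def goodSet (s a : Ω → ℝ) (K r u : ℝ) : Set Ω :=
  {y | (1 ≤ a y ∧ a y ≤ K) ∧ |s y - u * a y| ≤ r * a y}

/-- Tonelli's theorem exchanges the prior and the data, and the posterior bound is then applied for
each data point. -/
theorem integrated_risk_ge (ν : Measure Ω) [SFinite ν] {s a T : Ω → ℝ} (hs : Measurable s)
    (ha : Measurable a) (hT : Measurable T) {K r b : ℝ} (hr : 0 ≤ r) :
    ENNReal.ofReal (posteriorLoss K r) * ∫⁻ u in Icc (-(b - 2 * r)) (b - 2 * r),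
        ∫⁻ y in goodSet s a K r u, ENNReal.ofReal (quadLik (s y) (a y) u) ∂ν ≤
      ∫⁻ u in Icc (-b) b,
        ∫⁻ y, ENNReal.ofReal |T y - u| * ENNReal.ofReal (quadLik (s y) (a y) u) ∂ν := by
  have hlik : Measurable fun p : ℝ × Ω => ENNReal.ofReal (quadLik (s p.2) (a p.2) p.1) := by
    unfold quadLik; fun_prop
  have hG : MeasurableSet {p : ℝ × Ω | p.2 ∈ goodSet s a K r p.1} := by
    unfold goodSet
    simp only [mem_ofPred_eq]
    have m1 : MeasurableSet {p : ℝ × Ω | 1 ≤ a p.2} :=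
      measurableSet_le (by fun_prop) (by fun_prop)
    have m2 : MeasurableSet {p : ℝ × Ω | a p.2 ≤ K} :=
      measurableSet_le (by fun_prop) (by fun_prop)
    have m3 : MeasurableSet {p : ℝ × Ω | |s p.2 - p.1 * a p.2| ≤ r * a p.2} :=
      measurableSet_le (Measurable.abs (by fun_prop)) (by fun_prop)
    exact (m1.inter m2).inter m3
  have hGu : ∀ u, MeasurableSet (goodSet s a K r u) := fun u =>
    measurable_prodMk_left (x := u) hG
  have hgood : Measurable fun p : ℝ × Ω =>
      (goodSet s a K r p.1).indicator
        (fun y => ENNReal.ofReal (quadLik (s y) (a y) p.1)) p.2 := hlik.indicator hG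
  have hloss : Measurable fun p : ℝ × Ω =>
      ENNReal.ofReal |T p.2 - p.1| * ENNReal.ofReal (quadLik (s p.2) (a p.2) p.1) :=
    (Measurable.ennreal_ofReal (Measurable.abs (by fun_prop))).mul hlik
  have hind : ∀ u, ∫⁻ y in goodSet s a K r u, ENNReal.ofReal (quadLik (s y) (a y) u) ∂ν =
      ∫⁻ y, (goodSet s a K r u).indicator (fun y => ENNReal.ofReal (quadLik (s y) (a y) u)) y ∂ν :=
    fun u => (lintegral_indicator (hGu u) _).symm
  simp only [hind]
  have hswap := lintegral_lintegral_swap (μ := volume.restrict (Icc (-b) b)) (ν := ν)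
    (f := fun u y => ENNReal.ofReal |T y - u| * ENNReal.ofReal (quadLik (s y) (a y) u))
    hloss.aemeasurable
  rw [hswap, lintegral_lintegral_swap hgood.aemeasurable,
    ← lintegral_const_mul' _ _ ENNReal.ofReal_ne_top]
  refine lintegral_mono fun y => ?_
  by_cases hy : 1 ≤ a y ∧ a y ≤ K
  · refine le_trans (le_of_eq ?_) (posterior_loss_ge (b := b) hy.1 hy.2 hr (s y) (T y))
    congr 1
    refine lintegral_congr fun u => ?_
    simp [indicator, goodSet, hy]
  · have : ∀ u, (goodSet s a K r u).indicator
        (fun y => ENNReal.ofReal (quadLik (s y) (a y) u)) y = 0 := fun u =>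
      indicator_of_notMem (fun h => hy h.1) _
    simp [this]

/-- Tilting the parameter by `c = ±r` multiplies the likelihood by at least `exp (r² / 2)` where the
information is at least one and the centred score exceeds `r` times the information; as the tilted
likelihood still has mass one, the region carries little mass under `u`. -/
theorem tail_mass_le (ν : Measure Ω) {s a : Ω → ℝ} (hs : Measurable s) (ha : Measurable a)
    (h1 : ∀ u, ∫⁻ y, ENNReal.ofReal (quadLik (s y) (a y) u) ∂ν = 1) {r c : ℝ}
    (hc : c ^ 2 = r ^ 2) (u : ℝ) :
    ∫⁻ y in {y | 1 ≤ a y ∧ r ^ 2 * a y ≤ c * (s y - u * a y)},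
      ENNReal.ofReal (quadLik (s y) (a y) u) ∂ν ≤ ENNReal.ofReal (Real.exp (-r ^ 2 / 2)) := by
  have hm : MeasurableSet {y | 1 ≤ a y ∧ r ^ 2 * a y ≤ c * (s y - u * a y)} := by
    have m1 : MeasurableSet {y | 1 ≤ a y} := measurableSet_le (by fun_prop) (by fun_prop)
    have m2 : MeasurableSet {y | r ^ 2 * a y ≤ c * (s y - u * a y)} :=
      measurableSet_le (by fun_prop) (by fun_prop)
    exact m1.inter m2
  calc _ ≤ ∫⁻ y in {y | 1 ≤ a y ∧ r ^ 2 * a y ≤ c * (s y - u * a y)},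
      ENNReal.ofReal (Real.exp (-r ^ 2 / 2)) *
        ENNReal.ofReal (quadLik (s y) (a y) (u + c)) ∂ν := by
        refine setLIntegral_mono' hm fun y hy => ?_
        rw [← ENNReal.ofReal_mul (Real.exp_pos _).le]
        refine ENNReal.ofReal_le_ofReal ?_
        rw [quadLik, quadLik, ← Real.exp_add]
        refine Real.exp_le_exp.2 ?_
        have h2 : r ^ 2 ≤ r ^ 2 * a y := le_mul_of_one_le_right (sq_nonneg r) hy.1
        have h3 := hy.2
        have h4 : c ^ 2 * a y = r ^ 2 * a y := by rw [hc]
        nlinarith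
    _ ≤ ∫⁻ y, ENNReal.ofReal (Real.exp (-r ^ 2 / 2)) *
        ENNReal.ofReal (quadLik (s y) (a y) (u + c)) ∂ν := setLIntegral_le_lintegral _ _
    _ = ENNReal.ofReal (Real.exp (-r ^ 2 / 2)) := by
        rw [lintegral_const_mul' _ _ ENNReal.ofReal_ne_top, h1, mul_one]

/-- Up to the two tails of the centred score, a parameter puts on its good set all the mass that it
puts on the data with information in `[1, K]`. -/
theorem goodSet_mass_ge (ν : Measure Ω) {s a : Ω → ℝ} (hs : Measurable s) (ha : Measurable a)
    (h1 : ∀ u, ∫⁻ y, ENNReal.ofReal (quadLik (s y) (a y) u) ∂ν = 1) {K r η u : ℝ} (hr : 0 ≤ r)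
    (hη : 0 ≤ η) (hA : ∫⁻ y in {y | ¬ (1 ≤ a y ∧ a y ≤ K)},
      ENNReal.ofReal (quadLik (s y) (a y) u) ∂ν ≤ ENNReal.ofReal η) :
    ENNReal.ofReal (1 - η - 2 * Real.exp (-r ^ 2 / 2)) ≤
      ∫⁻ y in goodSet s a K r u, ENNReal.ofReal (quadLik (s y) (a y) u) ∂ν := by
  set f : Ω → ℝ≥0∞ := fun y => ENNReal.ofReal (quadLik (s y) (a y) u) with hf
  set e := Real.exp (-r ^ 2 / 2)
  have he : 0 ≤ e := (Real.exp_pos _).le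
  have hcover : (univ : Set Ω) ⊆ goodSet s a K r u ∪ ({y | ¬ (1 ≤ a y ∧ a y ≤ K)} ∪
      ({y | 1 ≤ a y ∧ r ^ 2 * a y ≤ r * (s y - u * a y)} ∪
        {y | 1 ≤ a y ∧ r ^ 2 * a y ≤ -r * (s y - u * a y)})) := by
    intro y _
    by_cases hy : 1 ≤ a y ∧ a y ≤ K
    · by_cases hB : |s y - u * a y| ≤ r * a y
      · exact Or.inl ⟨hy, hB⟩
      · refine Or.inr (Or.inr ?_)
        rcases lt_abs.1 (not_le.1 hB) with h | h
        · exact Or.inl ⟨hy.1, by nlinarith⟩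
        · exact Or.inr ⟨hy.1, by nlinarith⟩
    · exact Or.inr (Or.inl hy)
  have h2 : (1 : ℝ≥0∞) ≤ (∫⁻ y in goodSet s a K r u, f y ∂ν) + ENNReal.ofReal (η + 2 * e) := by
    calc (1 : ℝ≥0∞) = ∫⁻ y in univ, f y ∂ν := by rw [setLIntegral_univ, h1 u]
      _ ≤ _ := lintegral_mono_set hcover
      _ ≤ _ := lintegral_union_le _ _ _
      _ ≤ (∫⁻ y in goodSet s a K r u, f y ∂ν) + (ENNReal.ofReal η +
            (ENNReal.ofReal e + ENNReal.ofReal e)) := by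
          gcongr
          refine (lintegral_union_le _ _ _).trans (add_le_add hA ?_)
          exact (lintegral_union_le _ _ _).trans (add_le_add (tail_mass_le ν hs ha h1 rfl u)
            (tail_mass_le ν hs ha h1 (neg_sq r) u))
      _ = _ := by
          rw [← ENNReal.ofReal_add he he, ← ENNReal.ofReal_add hη (by positivity), two_mul]
  rw [show 1 - η - 2 * e = 1 - (η + 2 * e) by ring, ENNReal.ofReal_sub _ (by positivity),
    ENNReal.ofReal_one]
  exact tsub_le_iff_right.2 h2

/-- The Bayes bound: the maximal absolute loss over `[-b, b]` dominates the integrated one. -/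
theorem maximal_risk_ge (ν : Measure Ω) [SFinite ν] {s a T : Ω → ℝ} (hs : Measurable s)
    (ha : Measurable a) (hT : Measurable T)
    (h1 : ∀ u, ∫⁻ y, ENNReal.ofReal (quadLik (s y) (a y) u) ∂ν = 1) {K r b η : ℝ} (hr : 0 ≤ r)
    (hb : 0 < b) (hrb : 2 * r ≤ b) (hη : 0 ≤ η)
    (hA : ∀ u ∈ Icc (-b) b, ∫⁻ y in {y | ¬ (1 ≤ a y ∧ a y ≤ K)},
      ENNReal.ofReal (quadLik (s y) (a y) u) ∂ν ≤ ENNReal.ofReal η) {R : ℝ≥0∞}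
    (hR : ∀ u ∈ Icc (-b) b,
      ∫⁻ y, ENNReal.ofReal |T y - u| * ENNReal.ofReal (quadLik (s y) (a y) u) ∂ν ≤ R) :
    ENNReal.ofReal (posteriorLoss K r * (1 - η - 2 * Real.exp (-r ^ 2 / 2)) *
      ((b - 2 * r) / b)) ≤ R := by
  set q := 1 - η - 2 * Real.exp (-r ^ 2 / 2) with hq
  have h := integrated_risk_ge ν hs ha hT (K := K) (r := r) (b := b) hr
  have hup : ∫⁻ u in Icc (-b) b, ∫⁻ y, ENNReal.ofReal |T y - u| *
      ENNReal.ofReal (quadLik (s y) (a y) u) ∂ν ≤ R * ENNReal.ofReal (2 * b) := by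
    refine (setLIntegral_mono' measurableSet_Icc hR).trans (le_of_eq ?_)
    rw [setLIntegral_const, Real.volume_Icc]
    congr 2; ring
  have hlow : ENNReal.ofReal q * ENNReal.ofReal (2 * (b - 2 * r)) ≤
      ∫⁻ u in Icc (-(b - 2 * r)) (b - 2 * r),
        ∫⁻ y in goodSet s a K r u, ENNReal.ofReal (quadLik (s y) (a y) u) ∂ν := by
    refine le_trans (le_of_eq ?_) (setLIntegral_mono' (f := fun _ => ENNReal.ofReal q)
      measurableSet_Icc fun u hu => goodSet_mass_ge ν hs ha h1 hr hη
        (hA u (Icc_subset_Icc (by linarith) (by linarith) hu)))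
    rw [setLIntegral_const, Real.volume_Icc]
    congr 2; ring
  have h2 : ENNReal.ofReal (posteriorLoss K r) *
      (ENNReal.ofReal q * ENNReal.ofReal (2 * (b - 2 * r))) ≤ R * ENNReal.ofReal (2 * b) :=
    (mul_le_mul_right hlow _).trans (h.trans hup)
  have hb' : ENNReal.ofReal (2 * b) ≠ 0 := by simpa using hb
  refine (ENNReal.mul_le_mul_iff_left hb' ENNReal.ofReal_ne_top).1 (le_trans (le_of_eq ?_) h2)
  rw [← ENNReal.ofReal_mul' (by linarith), ← ENNReal.ofReal_mul' (by linarith),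
    ← ENNReal.ofReal_mul (posteriorLoss_nonneg K r)]
  congr 1
  field_simp

end Bayes

/-! ### Concentration of the information -/

theorem memLp_eval_gaussian (n : ℕ) (k : Fin n) :
    MemLp (fun ξ : Fin n → ℝ => ξ k) 2 (Measure.pi fun _ => gaussianReal 0 1) :=
  (memLp_id_gaussianReal' (μ := 0) (v := 1) 2 (by simp)).comp_measurePreserving
    (measurePreserving_eval (fun _ : Fin n => gaussianReal 0 1) k)

theorem integral_eval_sq_gaussian (n : ℕ) (k : Fin n) :
    ∫ ξ : Fin n → ℝ, ξ k ^ 2 ∂(Measure.pi fun _ => gaussianReal 0 1) = 1 := by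
  rw [integral_comp_eval (μ := fun _ : Fin n => gaussianReal 0 1) (f := fun x : ℝ => x ^ 2)
    (by fun_prop), integral_sq_gaussianReal]

/-- For uniformly small coefficients the states have bounded second moments. -/
theorem path_second_moment {n : ℕ} (y₀ : ℝ) {S : ℝ → ℝ}
    (hS : ∀ k < n, |coeff n S k| ≤ 1 / 2) {k : ℕ} (hk : k ≤ n) :
    MemLp (fun ξ => path n y₀ S ξ k) 2 (Measure.pi fun _ => gaussianReal 0 1) ∧
      ∫ ξ, path n y₀ S ξ k ^ 2 ∂(Measure.pi fun _ => gaussianReal 0 1) ≤ y₀ ^ 2 + 4 := by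
  induction k with
  | zero =>
    refine ⟨memLp_const y₀, ?_⟩
    simp [path]
  | succ k ih =>
    obtain ⟨h1, h2⟩ := ih (Nat.le_of_succ_le hk)
    have hξ := memLp_eval_gaussian n ⟨k, hk⟩
    have h3 : MemLp (fun ξ => path n y₀ S ξ (k + 1)) 2
        (Measure.pi fun _ => gaussianReal 0 1) := by
      simp only [path_succ y₀ S _ hk]
      exact (h1.const_mul _).add hξ
    refine ⟨h3, ?_⟩
    calc ∫ ξ, path n y₀ S ξ (k + 1) ^ 2 ∂(Measure.pi fun _ => gaussianReal 0 1)
        ≤ ∫ ξ, (1 / 2 * path n y₀ S ξ k ^ 2 + 2 * ξ ⟨k, hk⟩ ^ 2)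
            ∂(Measure.pi fun _ => gaussianReal 0 1) := by
          refine integral_mono h3.integrable_sq
            ((h1.integrable_sq.const_mul _).add (hξ.integrable_sq.const_mul _)) fun ξ => ?_
          simp only [path_succ y₀ S ξ hk]
          have h4 : coeff n S k ^ 2 ≤ 1 / 4 := by
            have := sq_le_sq' (abs_le.1 (hS k hk)).1 (abs_le.1 (hS k hk)).2
            linarith
          nlinarith [sq_nonneg (coeff n S k * path n y₀ S ξ k - ξ ⟨k, hk⟩),
            sq_nonneg (path n y₀ S ξ k)]
      _ = 1 / 2 * (∫ ξ, path n y₀ S ξ k ^ 2 ∂(Measure.pi fun _ => gaussianReal 0 1)) + 2 := by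
          rw [integral_add (h1.integrable_sq.const_mul _) (hξ.integrable_sq.const_mul _),
            integral_const_mul, integral_const_mul, integral_eval_sq_gaussian, mul_one]
      _ ≤ y₀ ^ 2 + 4 := by nlinarith [sq_nonneg y₀]

/-- For small coefficients the squared states are close in mean to the squared noise variables. -/
theorem path_sq_sub_noise_sq {n : ℕ} (y₀ : ℝ) {S : ℝ → ℝ} {α : ℝ} (hα : α ≤ 1 / 2)
    (hS : ∀ k < n, |coeff n S k| ≤ α) (k : Fin n) :
    Integrable (fun ξ => path n y₀ S ξ (k + 1) ^ 2 - ξ k ^ 2)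
        (Measure.pi fun _ => gaussianReal 0 1) ∧
      ∫ ξ, |path n y₀ S ξ (k + 1) ^ 2 - ξ k ^ 2| ∂(Measure.pi fun _ => gaussianReal 0 1) ≤
        α * (2 * y₀ ^ 2 + 9) := by
  have hS' : ∀ k < n, |coeff n S k| ≤ 1 / 2 := fun k hk => (hS k hk).trans hα
  obtain ⟨h1, h2⟩ := path_second_moment y₀ hS' k.2.le
  have h3 := (path_second_moment y₀ hS' (k := k + 1) k.2).1
  have hξ := memLp_eval_gaussian n k
  have hint := h3.integrable_sq.sub hξ.integrable_sq
  have hα0 : 0 ≤ α := (abs_nonneg _).trans (hS k k.2)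
  refine ⟨hint, ?_⟩
  calc ∫ ξ, |path n y₀ S ξ (k + 1) ^ 2 - ξ k ^ 2| ∂(Measure.pi fun _ => gaussianReal 0 1)
      ≤ ∫ ξ, (α * (2 * path n y₀ S ξ k ^ 2) + α * ξ k ^ 2)
          ∂(Measure.pi fun _ => gaussianReal 0 1) := by
        refine integral_mono hint.abs
          (((h1.integrable_sq.const_mul _).const_mul _).add (hξ.integrable_sq.const_mul _))
          fun ξ => ?_
        simp only [path_succ y₀ S ξ k.2]
        set c := coeff n S k
        set p := path n y₀ S ξ k
        have h4 : |c| ≤ α := hS k k.2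
        have h5 : (c * p + ξ k) ^ 2 - ξ k ^ 2 = c * (c * p ^ 2 + 2 * p * ξ k) := by ring
        have h6 : |c * p ^ 2 + 2 * p * ξ k| ≤ 2 * p ^ 2 + ξ k ^ 2 := by
          have h7 := abs_le.1 (h4.trans hα)
          rw [abs_le]
          constructor <;> nlinarith [sq_nonneg (p + ξ k), sq_nonneg (p - ξ k), sq_nonneg p]
        rw [h5, abs_mul, ← mul_add]
        exact mul_le_mul h4 h6 (abs_nonneg _) hα0
    _ = α * (2 * ∫ ξ, path n y₀ S ξ k ^ 2 ∂(Measure.pi fun _ => gaussianReal 0 1)) + α := by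
        rw [integral_add ((h1.integrable_sq.const_mul _).const_mul _)
          (hξ.integrable_sq.const_mul _), integral_const_mul, integral_const_mul,
          integral_const_mul, integral_eval_sq_gaussian, mul_one]
    _ ≤ α * (2 * (y₀ ^ 2 + 4)) + α := by gcongr
    _ = _ := by ring

theorem variance_sq_gaussianReal : Var[fun x : ℝ => x ^ 2; gaussianReal 0 1] = 2 := by
  have h4 : MemLp (fun x : ℝ => x ^ 2) 2 (gaussianReal 0 1) := by
    refine (memLp_two_iff_integrable_sq (by fun_prop)).2 ?_
    simpa only [← pow_mul] using integrable_pow_gaussianReal 4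
  rw [variance_eq_sub h4, integral_sq_gaussianReal]
  simp only [Pi.pow_apply, ← pow_mul]
  rw [integral_pow_four_gaussianReal]
  norm_num

/-- Concentration of a weighted sum of squared states: Markov's inequality for the distance to the
same sum with squared noise variables, and Chebyshev's inequality for the latter. -/
theorem weighted_sum_concentration {n : ℕ} (y₀ : ℝ) {S : ℝ → ℝ} {α : ℝ} (hα : α ≤ 1 / 2)
    (hS : ∀ k < n, |coeff n S k| ≤ α) {w : Fin n → ℝ} {W D κ : ℝ} (hw : ∀ k, 0 ≤ w k)
    (hW : ∀ k, w k ≤ W) (hD : ∑ k, w k = D) (hκ : 0 < κ) :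
    (Measure.pi fun _ => gaussianReal 0 1)
        {ξ | κ ≤ |(∑ k, w k * path n y₀ S ξ (k + 1) ^ 2) - D|} ≤
      ENNReal.ofReal (2 * α * (2 * y₀ ^ 2 + 9) * D / κ + 8 * W * D / κ ^ 2) := by
  set P : Measure (Fin n → ℝ) := Measure.pi fun _ => gaussianReal 0 1 with hP
  set X : (Fin n → ℝ) → ℝ := fun ξ => ∑ k, w k * |path n y₀ S ξ (k + 1) ^ 2 - ξ k ^ 2| with hX
  set Z : Fin n → ℝ → ℝ := fun k x => w k * x ^ 2 with hZ
  set Y : (Fin n → ℝ) → ℝ := ∑ k, fun ξ => Z k (ξ k) with hY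
  have hD0 : 0 ≤ D := hD ▸ Finset.sum_nonneg fun k _ => hw k
  have hterm := path_sq_sub_noise_sq y₀ hα hS
  have hXint : Integrable X P :=
    integrable_finsetSum _ fun k _ => ((hterm k).1.abs).const_mul _
  have hX0 : ∀ ξ, 0 ≤ X ξ := fun ξ =>
    Finset.sum_nonneg fun k _ => mul_nonneg (hw k) (abs_nonneg _)
  have hXle : ∫ ξ, X ξ ∂P ≤ α * (2 * y₀ ^ 2 + 9) * D := by
    rw [hX, integral_finsetSum _ fun k _ => ((hterm k).1.abs).const_mul _, ← hD,
      Finset.mul_sum]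
    refine Finset.sum_le_sum fun k _ => ?_
    rw [integral_const_mul, mul_comm]
    exact mul_le_mul_of_nonneg_right (hterm k).2 (hw k)
  have hZmem : ∀ k, MemLp (Z k) 2 (gaussianReal 0 1) := fun k => by
    refine MemLp.const_mul ?_ _
    refine (memLp_two_iff_integrable_sq (by fun_prop)).2 ?_
    simpa only [← pow_mul] using integrable_pow_gaussianReal 4
  have hYmem : MemLp Y 2 P := by
    refine memLp_finsetSum' _ fun k _ => ?_
    exact (hZmem k).comp_measurePreserving
      (measurePreserving_eval (fun _ : Fin n => gaussianReal 0 1) k)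
  have hYmean : ∫ ξ, Y ξ ∂P = D := by
    simp only [hY, Finset.sum_apply, hZ]
    rw [integral_finsetSum _ fun k _ => (memLp_eval_gaussian n k).integrable_sq.const_mul _, ← hD]
    refine Finset.sum_congr rfl fun k _ => ?_
    rw [integral_const_mul, integral_eval_sq_gaussian, mul_one]
  have hYvar : Var[Y; P] ≤ 2 * W * D := by
    rw [hY, hP, variance_sum_pi hZmem, ← hD, Finset.mul_sum]
    refine Finset.sum_le_sum fun k _ => ?_
    rw [hZ, variance_const_mul, variance_sq_gaussianReal]
    nlinarith [hw k, hW k]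
  have hsub : {ξ | κ ≤ |(∑ k, w k * path n y₀ S ξ (k + 1) ^ 2) - D|} ⊆
      {ξ | κ / 2 ≤ X ξ} ∪ {ξ | κ / 2 ≤ |Y ξ - ∫ ξ, Y ξ ∂P|} := by
    intro ξ hξ
    have hξ' : κ ≤ |(∑ k, w k * path n y₀ S ξ (k + 1) ^ 2) - D| := hξ
    by_contra hcon
    have hc1 : ¬ κ / 2 ≤ X ξ := fun h => hcon (Or.inl h)
    have hc2 : ¬ κ / 2 ≤ |Y ξ - ∫ ξ, Y ξ ∂P| := fun h => hcon (Or.inr h)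
    rw [hYmean] at hc2
    have h1 : |(∑ k, w k * path n y₀ S ξ (k + 1) ^ 2) - Y ξ| ≤ X ξ := by
      simp only [hY, Finset.sum_apply, hZ, hX]
      rw [← Finset.sum_sub_distrib]
      refine (Finset.abs_sum_le_sum_abs _ _).trans (le_of_eq ?_)
      refine Finset.sum_congr rfl fun k _ => ?_
      rw [← mul_sub, abs_mul, abs_of_nonneg (hw k)]
    have h2 := abs_sub_le (∑ k, w k * path n y₀ S ξ (k + 1) ^ 2) (Y ξ) D
    linarith
  have hmarkov : P {ξ | κ / 2 ≤ X ξ} ≤ ENNReal.ofReal (2 * α * (2 * y₀ ^ 2 + 9) * D / κ) := by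
    have h := mul_meas_ge_le_integral_of_nonneg (ae_of_all P hX0) hXint (κ / 2)
    rw [← ofReal_measureReal]
    refine ENNReal.ofReal_le_ofReal ?_
    rw [le_div_iff₀ hκ]
    linarith
  have hcheb : P {ξ | κ / 2 ≤ |Y ξ - ∫ ξ, Y ξ ∂P|} ≤ ENNReal.ofReal (8 * W * D / κ ^ 2) := by
    refine (meas_ge_le_variance_div_sq hYmem (half_pos hκ)).trans (ENNReal.ofReal_le_ofReal ?_)
    rw [div_le_div_iff₀ (by positivity) (by positivity)]
    nlinarith [sq_nonneg κ, mul_le_mul_of_nonneg_right hYvar (sq_nonneg κ)]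
  -- Without observations the signs of `α` and `W` are not constrained.
  rcases isEmpty_or_nonempty (Fin n) with hn | ⟨⟨k⟩⟩
  · have : D = 0 := by simp [← hD]
    subst this
    simp [not_le.2 hκ]
  have hα0 : 0 ≤ α := (abs_nonneg _).trans (hS k k.2)
  have hW0 : 0 ≤ W := (hw k).trans (hW k)
  rw [ENNReal.ofReal_add (by positivity) (by positivity)]
  exact (measure_mono hsub).trans ((measure_union_le _ _).trans (add_le_add hmarkov hcheb))

/-! ### The minimax bound over a one-parameter family -/

/-- The score at zero of the family of coefficients `u ↦ u • g`. -/
def score {n : ℕ} (y₀ : ℝ) (g : ℝ → ℝ) (y : Fin n → ℝ) : ℝ :=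
  ∑ k : Fin n, coeff n g k * lag y₀ y k * y k

/-- The observed information of the family of coefficients `u ↦ u • g`. -/
def information {n : ℕ} (y₀ : ℝ) (g : ℝ → ℝ) (y : Fin n → ℝ) : ℝ :=
  ∑ k : Fin n, coeff n g k ^ 2 * lag y₀ y k ^ 2

theorem measurable_score {n : ℕ} (y₀ : ℝ) (g : ℝ → ℝ) : Measurable (score (n := n) y₀ g) := by
  unfold score
  have := fun k => measurable_lag (n := n) y₀ k
  fun_prop

theorem measurable_information {n : ℕ} (y₀ : ℝ) (g : ℝ → ℝ) :
    Measurable (information (n := n) y₀ g) := by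
  unfold information
  have := fun k => measurable_lag (n := n) y₀ k
  fun_prop

theorem exp_logLikelihood_smul {n : ℕ} (y₀ : ℝ) (g : ℝ → ℝ) (u : ℝ) (y : Fin n → ℝ) :
    Real.exp (logLikelihood y₀ (u • g) y) = quadLik (score y₀ g y) (information y₀ g y) u := by
  rw [quadLik, logLikelihood, score, information, Finset.mul_sum, Finset.mul_sum, Finset.sum_div,
    ← Finset.sum_sub_distrib]
  congr 1
  refine Finset.sum_congr rfl fun k _ => ?_
  simp only [coeff, Pi.smul_apply, smul_eq_mul]
  ring

theorem obsLaw_smul (n : ℕ) (y₀ : ℝ) (g : ℝ → ℝ) (u : ℝ) :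
    obsLaw n y₀ (u • g) (gaussianPDFReal 0 1) = (noiseLaw n (gaussianPDFReal 0 1)).withDensity
      fun y => ENNReal.ofReal (quadLik (score y₀ g y) (information y₀ g y) u) := by
  rw [obsLaw_gaussian]
  simp only [exp_logLikelihood_smul]

/-- The information in terms of the states. As the end weights vanish, the summation index can be
shifted so that the state `k + 1` is paired with the noise variable entering it. -/
theorem information_observations {n : ℕ} (y₀ : ℝ) {g : ℝ → ℝ} (S : ℝ → ℝ)
    (h0 : coeff n g 0 = 0) (hn : coeff n g n = 0) (ξ : Fin n → ℝ) :
    information y₀ g (observations n y₀ S ξ) =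
      ∑ k : Fin n, coeff n g (k + 1) ^ 2 * path n y₀ S ξ (k + 1) ^ 2 := by
  have h1 : information y₀ g (observations n y₀ S ξ) =
      ∑ k ∈ Finset.range n, coeff n g k ^ 2 * path n y₀ S ξ k ^ 2 := by
    rw [information, ← Fin.sum_univ_eq_sum_range
      (fun k => coeff n g k ^ 2 * path n y₀ S ξ k ^ 2)]
    refine Finset.sum_congr rfl fun k _ => ?_
    rw [lag_observations y₀ S ξ k.2.le]
  have h2 := Finset.sum_range_succ (fun k => coeff n g k ^ 2 * path n y₀ S ξ k ^ 2) n
  have h3 := Finset.sum_range_succ' (fun k => coeff n g k ^ 2 * path n y₀ S ξ k ^ 2) n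
  rw [h1, Fin.sum_univ_eq_sum_range
    (fun k => coeff n g (k + 1) ^ 2 * path n y₀ S ξ (k + 1) ^ 2)]
  simp only [h0, hn] at h2 h3
  linarith

/-- A nonasymptotic lower bound for the maximal risk over the family `u • g`, `|u| ≤ b`, whose
information is close to a deterministic number `D ≈ 2`. -/
theorem family_risk_ge {n : ℕ} (y₀ : ℝ) {g : ℝ → ℝ} {ψ b r κ D η : ℝ}
    (h0 : coeff n g 0 = 0) (hn : coeff n g n = 0) (hψ : ∀ k, |coeff n g k| ≤ ψ)
    (hD : ∑ k : Fin n, coeff n g (k + 1) ^ 2 = D) (hD₁ : 1 + κ ≤ D) (hD₂ : D ≤ 2 + κ)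
    (hκ : 0 < κ) (hr : 0 ≤ r) (hb : 0 < b) (hrb : 2 * r ≤ b) (hbψ : b * ψ ≤ 1 / 2)
    (hη : 2 * (b * ψ) * (2 * y₀ ^ 2 + 9) * D / κ + 8 * ψ ^ 2 * D / κ ^ 2 ≤ η)
    {T : (Fin n → ℝ) → ℝ} (hT : Measurable T) {R : ℝ≥0∞}
    (hR : ∀ u ∈ Icc (-b) b,
      ∫⁻ y, ENNReal.ofReal |T y - u| ∂(obsLaw n y₀ (u • g) (gaussianPDFReal 0 1)) ≤ R) :
    ENNReal.ofReal (posteriorLoss (2 + 2 * κ) r * (1 - η - 2 * Real.exp (-r ^ 2 / 2)) *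
      ((b - 2 * r) / b)) ≤ R := by
  have hψ0 : 0 ≤ ψ := (abs_nonneg _).trans (hψ 0)
  have hprob : IsProbabilityMeasure (noiseLaw n (gaussianPDFReal 0 1)) := by
    rw [noiseLaw_gaussian]; infer_instance
  have hs := measurable_score (n := n) y₀ g
  have ha := measurable_information (n := n) y₀ g
  have hlik : ∀ u, Measurable fun y : Fin n → ℝ =>
      ENNReal.ofReal (quadLik (score y₀ g y) (information y₀ g y) u) := fun u => by
    unfold quadLik; fun_prop
  have hD0 : 0 ≤ D := by linarith
  refine maximal_risk_ge (noiseLaw n (gaussianPDFReal 0 1)) hs ha hT ?_ hr hb hrb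
    (le_trans (by positivity) hη) ?_ ?_
  · intro u
    rw [← setLIntegral_univ, ← withDensity_apply _ MeasurableSet.univ, ← obsLaw_smul, obsLaw,
      Measure.map_apply (measurable_observations _ _ _) MeasurableSet.univ, preimage_univ,
      measure_univ]
  · intro u hu
    have hm : MeasurableSet {y : Fin n → ℝ |
        ¬ (1 ≤ information y₀ g y ∧ information y₀ g y ≤ 2 + 2 * κ)} := by
      have m1 : MeasurableSet {y : Fin n → ℝ | 1 ≤ information y₀ g y} :=
        measurableSet_le (by fun_prop) (by fun_prop)
      have m2 : MeasurableSet {y : Fin n → ℝ | information y₀ g y ≤ 2 + 2 * κ} :=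
        measurableSet_le (by fun_prop) (by fun_prop)
      exact (m1.inter m2).compl
    rw [← withDensity_apply _ hm, ← obsLaw_smul, obsLaw,
      Measure.map_apply (measurable_observations _ _ _) hm, noiseLaw_gaussian]
    have hS : ∀ k < n, |coeff n (u • g) k| ≤ b * ψ := fun k _ => by
      have : coeff n (u • g) k = u * coeff n g k := rfl
      rw [this, abs_mul]
      exact mul_le_mul (abs_le.2 hu) (hψ k) (abs_nonneg _) hb.le
    refine le_trans (measure_mono ?_) ((weighted_sum_concentration y₀ hbψ hS
      (w := fun k => coeff n g (k + 1) ^ 2) (W := ψ ^ 2) (fun k => sq_nonneg _)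
      (fun k => sq_le_sq' (by linarith [(abs_le.1 (hψ (k + 1))).1]) (abs_le.1 (hψ (k + 1))).2)
      hD hκ).trans (ENNReal.ofReal_le_ofReal hη))
    intro ξ hξ
    have hξ' : ¬ (1 ≤ information y₀ g (observations n y₀ (u • g) ξ) ∧
      information y₀ g (observations n y₀ (u • g) ξ) ≤ 2 + 2 * κ) := hξ
    rw [information_observations y₀ (u • g) h0 hn] at hξ'
    have : κ ≤ |(∑ k : Fin n, coeff n g (k + 1) ^ 2 * path n y₀ (u • g) ξ (k + 1) ^ 2) - D| := by
      by_contra hlt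
      have := abs_lt.1 (not_le.1 hlt)
      exact hξ' ⟨by linarith [this.1], by linarith [this.2]⟩
    exact this
  · intro u hu
    refine le_trans (le_of_eq ?_) (hR u hu)
    rw [obsLaw_smul, lintegral_withDensity_eq_lintegral_mul _ (hlik u) (by fun_prop)]
    refine lintegral_congr fun y => ?_
    rw [Pi.mul_apply, mul_comm]

/-! ### The perturbations -/

/-- A smooth approximation of the indicator of `[-1, 1]`, equal to one on `[-(1 - ρ), 1 - ρ]`. -/
def plateau {ρ : ℝ} (h₀ : 0 < ρ) (h₁ : ρ < 1) : ContDiffBump (0 : ℝ) where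
  rIn := 1 - ρ
  rOut := 1
  rIn_pos := by linarith
  rIn_lt_rOut := by linarith

/-- The bump of height `ψ` and bandwidth `h` at `z₀`. -/
def perturbation {c : ℝ} (V : ContDiffBump c) (ψ h z₀ : ℝ) (x : ℝ) : ℝ := ψ * V ((x - z₀) / h)

section Plateau

variable {ρ : ℝ} (h₀ : 0 < ρ) (h₁ : ρ < 1)

theorem plateau_eq_one {t : ℝ} (ht : |t| ≤ 1 - ρ) : plateau h₀ h₁ t = 1 :=
  (plateau h₀ h₁).one_of_mem_closedBall (by simpa [plateau] using ht)

theorem plateau_eq_zero {t : ℝ} (ht : 1 ≤ |t|) : plateau h₀ h₁ t = 0 :=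
  (plateau h₀ h₁).zero_of_le_dist (by simpa [plateau] using ht)

theorem plateau_zero : plateau h₀ h₁ 0 = 1 := plateau_eq_one h₀ h₁ (by simpa using h₁.le)

theorem abs_integral_plateau_sub_one_le :
    |∫ t in (-1 : ℝ)..1, (plateau h₀ h₁ t - 1)| ≤ 2 * ρ := by
  set V := plateau h₀ h₁ with hV
  have hi : ∀ x y, IntervalIntegrable V volume x y := fun x y =>
    V.continuous.intervalIntegrable x y
  rw [intervalIntegral.integral_sub (hi _ _) (by simp)]
  have hup : ∫ t in (-1 : ℝ)..1, V t ≤ ∫ t in (-1 : ℝ)..1, (1 : ℝ) :=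
    intervalIntegral.integral_mono_on (by norm_num) (hi _ _) (by simp) fun t _ => V.le_one
  have hlow : ∫ t in (-(1 - ρ))..(1 - ρ), V t ≤ ∫ t in (-1 : ℝ)..1, V t :=
    intervalIntegral.integral_mono_interval (by linarith) (by linarith) (by linarith)
      (ae_of_all _ fun t => V.nonneg) (hi _ _)
  have hone : ∫ t in (-(1 - ρ))..(1 - ρ), V t = ∫ t in (-(1 - ρ))..(1 - ρ), (1 : ℝ) := by
    refine intervalIntegral.integral_congr fun t ht => ?_
    rw [uIcc_of_le (by linarith)] at ht
    exact plateau_eq_one h₀ h₁ (abs_le.2 ht)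
  rw [hone] at hlow
  simp only [intervalIntegral.integral_const, smul_eq_mul, mul_one] at hup hlow ⊢
  rw [abs_le]
  constructor <;> linarith

theorem exists_abs_deriv_le {c : ℝ} (V : ContDiffBump c) : ∃ M, ∀ t, |deriv V t| ≤ M := by
  obtain ⟨M, hM⟩ := (V.contDiff (n := 1)).continuous_deriv_one.bounded_above_of_compact_support
    V.hasCompactSupport.deriv
  exact ⟨M, hM⟩

theorem contDiff_perturbation {c : ℝ} (V : ContDiffBump c) (ψ h z₀ : ℝ) :
    ContDiff ℝ 1 (perturbation V ψ h z₀) :=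
  contDiff_const.mul (V.contDiff.comp ((contDiff_id.sub contDiff_const).div_const h))

theorem deriv_perturbation {c : ℝ} (V : ContDiffBump c) (ψ h z₀ x : ℝ) :
    deriv (perturbation V ψ h z₀) x = ψ * (deriv V ((x - z₀) / h) * (1 / h)) := by
  have h1 : HasDerivAt (fun x => (x - z₀) / h) (1 / h) x :=
    ((hasDerivAt_id x).sub_const z₀).div_const h
  have h2 : HasDerivAt V (deriv V ((x - z₀) / h)) ((x - z₀) / h) :=
    ((V.contDiff (n := 1)).differentiable one_ne_zero _).hasDerivAt
  exact ((h2.comp x h1).const_mul ψ).deriv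

theorem abs_perturbation_le {c : ℝ} (V : ContDiffBump c) {ψ : ℝ} (hψ : 0 ≤ ψ) (h z₀ x : ℝ) :
    |perturbation V ψ h z₀ x| ≤ ψ := by
  rw [perturbation, abs_mul, abs_of_nonneg hψ, abs_of_nonneg V.nonneg]
  exact mul_le_of_le_one_right hψ V.le_one

/-- Membership in the weak Hölder class. The derivative is of order `h ^ (β - 1)`, and the averaged
increment is at most `2 ρ |u| h ^ β`, since the plateau differs from one only on length `2 ρ`. -/
theorem smul_perturbation_mem {β δ z₀ ε b M u : ℝ} {n : ℕ} (hh : 0 < bandwidth β n)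
    (hM : ∀ t, |deriv (plateau h₀ h₁) t| ≤ M)
    (h1 : b * bandwidth β n ^ β ≤ 1 - ε)
    (h2 : b * bandwidth β n ^ β * M / bandwidth β n ≤ δ⁻¹) (h3 : 2 * ρ * b ≤ δ) (hu : |u| ≤ b) :
    u • perturbation (plateau h₀ h₁) (bandwidth β n ^ β) (bandwidth β n) z₀ ∈
      weakHolderClass β δ n z₀ ε := by
  set h := bandwidth β n
  set V := plateau h₀ h₁
  have hψ : 0 < h ^ β := Real.rpow_pos_of_pos hh β
  have hcd : ContDiff ℝ 1 (u • perturbation V (h ^ β) h z₀) :=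
    contDiff_const.smul (contDiff_perturbation V _ _ _)
  refine ⟨⟨hcd.contDiffOn, fun x _ => ?_⟩, fun x hx => ?_, ?_⟩
  · rw [Pi.smul_apply, smul_eq_mul, abs_mul]
    exact (mul_le_mul hu (abs_perturbation_le V hψ.le h z₀ x) (abs_nonneg _)
      ((abs_nonneg _).trans hu)).trans h1
  · have hd := (contDiff_perturbation V (h ^ β) h z₀).differentiable one_ne_zero
    rw [(hcd.differentiable one_ne_zero x).derivWithin (uniqueDiffOn_Icc_zero_one x hx),
      deriv_const_smul u (hd x), deriv_perturbation, smul_eq_mul, abs_mul, abs_mul, abs_mul,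
      abs_of_pos hψ, abs_of_pos (one_div_pos.2 hh)]
    refine le_trans ?_ h2
    rw [show b * h ^ β * M / h = b * (h ^ β * (M * (1 / h))) by ring]
    refine mul_le_mul hu ?_ (by positivity) ((abs_nonneg _).trans hu)
    gcongr
    exact hM _
  · have e : ∀ t : ℝ, (u • perturbation V (h ^ β) h z₀) (z₀ + t * h) -
        (u • perturbation V (h ^ β) h z₀) z₀ = u * h ^ β * (V t - 1) := by
      intro t
      simp only [Pi.smul_apply, perturbation, smul_eq_mul, add_sub_cancel_left, sub_self, zero_div,
        mul_div_cancel_right₀ _ hh.ne']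
      rw [show V 0 = 1 from plateau_zero h₀ h₁]
      ring
    change |∫ t in (-1 : ℝ)..1, ((u • perturbation V (h ^ β) h z₀) (z₀ + t * h) -
        (u • perturbation V (h ^ β) h z₀) z₀)| ≤ δ * h ^ β
    simp only [e]
    rw [intervalIntegral.integral_const_mul, abs_mul, abs_mul, abs_of_pos hψ]
    have h4 := abs_integral_plateau_sub_one_le h₀ h₁
    calc |u| * h ^ β * |∫ t in (-1 : ℝ)..1, (V t - 1)| ≤ b * h ^ β * (2 * ρ) := by
          refine mul_le_mul ?_ h4 (abs_nonneg _) ?_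
          · gcongr
          · exact mul_nonneg ((abs_nonneg _).trans hu) hψ.le
      _ = 2 * ρ * b * h ^ β := by ring
      _ ≤ δ * h ^ β := by gcongr

/-! ### The deterministic information -/

theorem card_filter_range_le {x y : ℝ} (hxy : x ≤ y) (hy : 0 ≤ y) (n : ℕ) :
    (((Finset.range n).filter fun k : ℕ => x ≤ k ∧ (k : ℝ) ≤ y).card : ℝ) ≤ y - x + 1 := by
  have hsub : ((Finset.range n).filter fun k : ℕ => x ≤ k ∧ (k : ℝ) ≤ y) ⊆
      Finset.Icc ⌈x⌉₊ ⌊y⌋₊ := by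
    intro k hk
    have := (Finset.mem_filter.1 hk).2
    exact Finset.mem_Icc.2 ⟨Nat.ceil_le.2 this.1, Nat.le_floor this.2⟩
  have h1 : (((Finset.range n).filter fun k : ℕ => x ≤ k ∧ (k : ℝ) ≤ y).card : ℝ) ≤
      ((⌊y⌋₊ + 1 - ⌈x⌉₊ : ℕ) : ℝ) := by
    rw [← Nat.card_Icc]
    exact_mod_cast Finset.card_le_card hsub
  refine h1.trans ?_
  have h2 := Nat.floor_le hy
  have h3 := Nat.le_ceil x
  rcases le_total ⌈x⌉₊ (⌊y⌋₊ + 1) with h | h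
  · rw [Nat.cast_sub h]
    push_cast
    linarith
  · rw [Nat.sub_eq_zero_of_le h]
    push_cast
    linarith

theorem le_card_filter_range {x y : ℝ} {n : ℕ} (hx : 0 ≤ x) (hxy : x ≤ y) (hy : y < n) :
    y - x - 1 ≤ (((Finset.range n).filter fun k : ℕ => x ≤ k ∧ (k : ℝ) ≤ y).card : ℝ) := by
  have hsub : Finset.Icc ⌈x⌉₊ ⌊y⌋₊ ⊆
      ((Finset.range n).filter fun k : ℕ => x ≤ k ∧ (k : ℝ) ≤ y) := by
    intro k hk
    obtain ⟨h1, h2⟩ := Finset.mem_Icc.1 hk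
    have h4 : (k : ℝ) ≤ y := (Nat.le_floor_iff (hx.trans hxy)).1 h2
    refine Finset.mem_filter.2 ⟨Finset.mem_range.2 ?_, Nat.ceil_le.1 h1, h4⟩
    exact_mod_cast h4.trans_lt hy
  have h1 : ((⌊y⌋₊ + 1 - ⌈x⌉₊ : ℕ) : ℝ) ≤
      (((Finset.range n).filter fun k : ℕ => x ≤ k ∧ (k : ℝ) ≤ y).card : ℝ) := by
    rw [← Nat.card_Icc]
    exact_mod_cast Finset.card_le_card hsub
  refine le_trans ?_ h1
  have h2 := Nat.lt_floor_add_one y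
  have h3 := Nat.ceil_lt_add_one hx
  have h4 : ((⌊y⌋₊ + 1 : ℕ) : ℝ) ≤ ((⌊y⌋₊ + 1 - ⌈x⌉₊ : ℕ) : ℝ) + (⌈x⌉₊ : ℝ) := by
    exact_mod_cast le_tsub_add
  push_cast at h4
  linarith

/-- The sum of squared weights is `ψ²` times the number of design points in a window of half-width
about `h`, that is about `2`; only the lower bound loses the part where the plateau is not flat. -/
theorem sum_sq_coeff_perturbation {n : ℕ} {z₀ h ψ : ℝ} (hh : 0 < h) (hψ : ψ ^ 2 * (n * h) = 1)
    (hz : 2 ≤ n * (z₀ - h)) (hz' : h ≤ 1 - z₀) :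
    2 * (1 - ρ) - ψ ^ 2 ≤
        ∑ k : Fin n, coeff n (perturbation (plateau h₀ h₁) ψ h z₀) (k + 1) ^ 2 ∧
      ∑ k : Fin n, coeff n (perturbation (plateau h₀ h₁) ψ h z₀) (k + 1) ^ 2 ≤ 2 + ψ ^ 2 := by
  set V := plateau h₀ h₁
  have hn : (0 : ℝ) < n := by
    rcases Nat.eq_zero_or_pos n with rfl | hn
    · norm_num at hz
    · exact_mod_cast hn
  have hnh : 0 < n * h := mul_pos hn hh
  have hsum : ∑ k : Fin n, coeff n (perturbation V ψ h z₀) (k + 1) ^ 2 =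
      ψ ^ 2 * ∑ k ∈ Finset.range n, V ((((k : ℝ) + 2) / n - z₀) / h) ^ 2 := by
    rw [Finset.mul_sum, ← Fin.sum_univ_eq_sum_range
      (fun k => ψ ^ 2 * V ((((k : ℝ) + 2) / n - z₀) / h) ^ 2)]
    refine Finset.sum_congr rfl fun k _ => ?_
    simp only [coeff, perturbation]
    push_cast
    rw [mul_pow]
    ring_nf
  have habs : ∀ (k : ℕ) (c : ℝ), |(((k : ℝ) + 2) / n - z₀) / h| ≤ c ↔
      n * (z₀ - c * h) - 2 ≤ k ∧ (k : ℝ) ≤ n * (z₀ + c * h) - 2 := by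
    intro k c
    rw [abs_le, le_div_iff₀ hh, div_le_iff₀ hh, le_sub_iff_add_le, sub_le_iff_le_add,
      le_div_iff₀ hn, div_le_iff₀ hn]
    constructor <;> rintro ⟨h1, h2⟩ <;> constructor <;> nlinarith
  rw [hsum]
  constructor
  · have hc : (1 - ρ) * h ≤ h := mul_le_of_le_one_left hh.le (by linarith)
    have hc0 : 0 ≤ (1 - ρ) * h := mul_nonneg (by linarith) hh.le
    have hcard := le_card_filter_range (n := n) (x := n * (z₀ - (1 - ρ) * h) - 2)
      (y := n * (z₀ + (1 - ρ) * h) - 2) (by nlinarith) (by nlinarith) (by nlinarith)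
    have hle : (((Finset.range n).filter fun k : ℕ => n * (z₀ - (1 - ρ) * h) - 2 ≤ k ∧
        (k : ℝ) ≤ n * (z₀ + (1 - ρ) * h) - 2).card : ℝ) ≤
        ∑ k ∈ Finset.range n, V ((((k : ℝ) + 2) / n - z₀) / h) ^ 2 := by
      rw [← Finset.sum_boole]
      refine Finset.sum_le_sum fun k _ => ?_
      split_ifs with hk
      · rw [plateau_eq_one h₀ h₁ ((habs k _).2 hk), one_pow]
      · exact sq_nonneg _
    calc 2 * (1 - ρ) - ψ ^ 2 = 2 * (1 - ρ) * (ψ ^ 2 * (n * h)) - ψ ^ 2 := by rw [hψ, mul_one]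
      _ = ψ ^ 2 * (n * (z₀ + (1 - ρ) * h) - 2 - (n * (z₀ - (1 - ρ) * h) - 2) - 1) := by ring
      _ ≤ _ := mul_le_mul_of_nonneg_left (hcard.trans hle) (sq_nonneg ψ)
  · have hcard := card_filter_range_le (x := n * (z₀ - 1 * h) - 2) (y := n * (z₀ + 1 * h) - 2)
      (by nlinarith) (by nlinarith) n
    have hle : ∑ k ∈ Finset.range n, V ((((k : ℝ) + 2) / n - z₀) / h) ^ 2 ≤
        (((Finset.range n).filter fun k : ℕ => n * (z₀ - 1 * h) - 2 ≤ k ∧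
          (k : ℝ) ≤ n * (z₀ + 1 * h) - 2).card : ℝ) := by
      rw [← Finset.sum_boole]
      refine Finset.sum_le_sum fun k _ => ?_
      split_ifs with hk
      · exact pow_le_one₀ V.nonneg V.le_one
      · rw [plateau_eq_zero h₀ h₁ (not_le.1 fun hle => hk ((habs k 1).1 hle)).le]
        norm_num
    calc ψ ^ 2 * ∑ k ∈ Finset.range n, V ((((k : ℝ) + 2) / n - z₀) / h) ^ 2
        ≤ ψ ^ 2 * (n * (z₀ + 1 * h) - 2 - (n * (z₀ - 1 * h) - 2) + 1) :=
          mul_le_mul_of_nonneg_left (hle.trans hcard) (sq_nonneg ψ)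
      _ = 2 * (ψ ^ 2 * (n * h)) + ψ ^ 2 := by ring
      _ = 2 + ψ ^ 2 := by rw [hψ, mul_one]

/-- The perturbation vanishes at a design point outside the window. -/
theorem coeff_perturbation_eq_zero {n k : ℕ} {z₀ h ψ : ℝ} (hh : 0 < h)
    (hk : h ≤ |((k + 1 : ℕ) : ℝ) / n - z₀|) :
    coeff n (perturbation (plateau h₀ h₁) ψ h z₀) k = 0 := by
  rw [coeff, perturbation, plateau_eq_zero h₀ h₁, mul_zero]
  rwa [abs_div, abs_of_pos hh, le_div_iff₀ hh, one_mul]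

end Plateau

/-! ### Asymptotics of the bandwidth and the conclusion -/

theorem bandwidth_pos (β : ℝ) {n : ℕ} (hn : 0 < n) : 0 < bandwidth β n :=
  Real.rpow_pos_of_pos (by exact_mod_cast hn) _

theorem tendsto_bandwidth {β : ℝ} (hβ : 1 < β) :
    Tendsto (fun n : ℕ => bandwidth β n) atTop (nhds 0) := by
  have h := (tendsto_rpow_neg_atTop (y := 1 / (2 * β + 1)) (by positivity)).comp
    tendsto_natCast_atTop_atTop
  refine h.congr fun n => ?_
  simp only [Function.comp, bandwidth, neg_div]

theorem tendsto_bandwidth_rpow {β c : ℝ} (hβ : 1 < β) (hc : 0 < c) :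
    Tendsto (fun n : ℕ => bandwidth β n ^ c) atTop (nhds 0) := by
  have h := (tendsto_bandwidth hβ).rpow_const (p := c) (Or.inr hc.le)
  rwa [Real.zero_rpow hc.ne'] at h

theorem bandwidth_rpow_mul_rate (β : ℝ) {n : ℕ} (hn : 0 < n) :
    bandwidth β n ^ β * rate β n = 1 := by
  have hn' : (0 : ℝ) < n := by exact_mod_cast hn
  rw [bandwidth, rate, ← Real.rpow_mul hn'.le, ← Real.rpow_add hn',
    show -1 / (2 * β + 1) * β + β / (2 * β + 1) = 0 by ring, Real.rpow_zero]

/-- The balance `ψ² n h = 1` between the squared height `ψ = h ^ β` of the perturbation and the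
number of design points in the window. -/
theorem bandwidth_rpow_sq_mul {β : ℝ} (hβ : 1 < β) {n : ℕ} (hn : 0 < n) :
    (bandwidth β n ^ β) ^ 2 * (n * bandwidth β n) = 1 := by
  have hn' : (0 : ℝ) < n := by exact_mod_cast hn
  have h1 : (n : ℝ) = (n : ℝ) ^ (1 : ℝ) := (Real.rpow_one _).symm
  have h2 : (2 * β + 1) ≠ 0 := by linarith
  have h3 : bandwidth β n = (n : ℝ) ^ (-1 / (2 * β + 1)) := rfl
  rw [h3, ← Real.rpow_mul hn'.le, ← Real.rpow_natCast, ← Real.rpow_mul hn'.le]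
  nth_rw 2 [h1]
  rw [← Real.rpow_add hn', ← Real.rpow_add hn']
  convert Real.rpow_zero _
  push_cast
  field_simp
  ring

/-- The rescaled loss of an estimator is at most the normalized risk; the factor `τ(S)` only helps,
as `τ(S) ≤ 1`. -/
theorem scaled_loss_le {n : ℕ} {y₀ σ z₀ φ ψ u : ℝ} {T : (Fin n → ℝ) → ℝ} {S p : ℝ → ℝ}
    (hp : IsNoiseDensity σ p) (hφ : 0 ≤ φ) (hψφ : ψ * φ = 1) (hS : S z₀ = u * ψ)
    (hS₁ : |S z₀| < 1) :
    ∫⁻ y, ENNReal.ofReal |φ * T y - u| ∂(obsLaw n y₀ S p) ≤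
      ENNReal.ofReal (tau z₀ S ^ (-1 / 2 : ℝ)) * ENNReal.ofReal φ * risk n y₀ σ z₀ T S := by
  have hu : u = φ * S z₀ := by
    rw [hS, show φ * (u * ψ) = u * (ψ * φ) by ring, hψφ, mul_one]
  have hsq : S z₀ ^ 2 < 1 := (sq_lt_one_iff_abs_lt_one _).2 hS₁
  have hτ : 1 ≤ tau z₀ S ^ (-1 / 2 : ℝ) :=
    Real.one_le_rpow_of_pos_of_le_one_of_nonpos (by rw [tau]; linarith)
      (by rw [tau]; linarith [sq_nonneg (S z₀)]) (by norm_num)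
  calc ∫⁻ y, ENNReal.ofReal |φ * T y - u| ∂(obsLaw n y₀ S p)
      = ENNReal.ofReal φ * ∫⁻ y, ENNReal.ofReal |T y - S z₀| ∂(obsLaw n y₀ S p) := by
        rw [← lintegral_const_mul' _ _ ENNReal.ofReal_ne_top]
        refine lintegral_congr fun y => ?_
        rw [← ENNReal.ofReal_mul hφ, hu, ← mul_sub, abs_mul, abs_of_nonneg hφ]
    _ ≤ 1 * ENNReal.ofReal φ * risk n y₀ σ z₀ T S := by
        rw [one_mul]
        refine mul_le_mul_right ?_ _
        exact le_iSup₂_of_le (f := fun (p : ℝ → ℝ) (_ : IsNoiseDensity σ p) =>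
          ∫⁻ y, ENNReal.ofReal |T y - S z₀| ∂(obsLaw n y₀ S p)) p hp le_rfl
    _ ≤ _ := by
        gcongr
        simpa using ENNReal.ofReal_le_ofReal hτ

/-- The lower bound obtained from the uniform prior on `[-r², r²]`, posterior neighbourhoods of
radius `r` and the tolerance `1 / r` for the deviation of the information from `2`. -/
def lowerBound (r : ℝ) : ℝ :=
  posteriorLoss (2 + 2 * (1 / (2 * r))) r * (1 - 1 / r - 2 * Real.exp (-r ^ 2 / 2)) *
    ((r ^ 2 - 2 * r) / r ^ 2)

/-- For fixed `r`, the nonasymptotic bound applies to the perturbations at all large `n`. -/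
theorem eventually_lowerBound_le {β z₀ σ δ ε r : ℝ} (hβ : 1 < β) (hz₀ : z₀ ∈ Ioo (0 : ℝ) 1)
    (y₀ : ℝ) (hσ : 3 ≤ σ) (hδ : 0 < δ) (hε₀ : 0 < ε) (hε₁ : ε < 1) (hr : 2 ≤ r) :
    ∀ᶠ n : ℕ in atTop,
      ENNReal.ofReal (lowerBound r) ≤ normalizedMinimaxRisk β δ y₀ σ z₀ ε n := by
  have hr0 : 0 < r := by linarith
  set b := r ^ 2 with hb
  set κ := 1 / (2 * r) with hκ
  have hb0 : 0 < b := by positivity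
  have hκ0 : 0 < κ := by positivity
  have hκ1 : κ ≤ 1 / 4 := by
    rw [hκ, div_le_div_iff₀ (by positivity) (by norm_num)]
    linarith
  -- The plateau has to be flat enough for the averaged increment, over the whole prior range.
  obtain ⟨ρ, hρ0, hρ1, hρb⟩ : ∃ ρ : ℝ, 0 < ρ ∧ ρ ≤ 1 / 8 ∧ 2 * ρ * b ≤ δ := by
    refine ⟨min (1 / 8) (δ / (2 * b)), lt_min (by norm_num) (by positivity), min_le_left _ _, ?_⟩
    have := min_le_right (1 / 8) (δ / (2 * b))
    rw [le_div_iff₀ (by positivity)] at this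
    linarith
  have hρ1' : ρ < 1 := by linarith
  obtain ⟨M, hM⟩ := exists_abs_deriv_le (plateau hρ0 hρ1')
  have hψ := tendsto_bandwidth_rpow hβ (c := β) (by linarith)
  have hh := tendsto_bandwidth hβ
  have t1 : Tendsto (fun n : ℕ => b * bandwidth β n ^ β) atTop (nhds 0) := by
    simpa using hψ.const_mul b
  have t2 : Tendsto (fun n : ℕ => b * M * bandwidth β n ^ (β - 1)) atTop (nhds 0) := by
    simpa using (tendsto_bandwidth_rpow hβ (c := β - 1) (by linarith)).const_mul (b * M)
  have t3 : Tendsto (fun n : ℕ => (bandwidth β n ^ β) ^ 2) atTop (nhds 0) := by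
    simpa using hψ.pow 2
  have t4 : Tendsto (fun n : ℕ => 2 * (b * bandwidth β n ^ β) * (2 * y₀ ^ 2 + 9) * (2 + κ) / κ +
      8 * (bandwidth β n ^ β) ^ 2 * (2 + κ) / κ ^ 2) atTop (nhds 0) := by
    have := (((((t1.const_mul 2).mul_const (2 * y₀ ^ 2 + 9)).mul_const (2 + κ)).div_const κ).add
      (((t3.const_mul 8).mul_const (2 + κ)).div_const (κ ^ 2)))
    simpa using this
  have hz := hz₀.1
  have hz' := hz₀.2
  filter_upwards [eventually_gt_atTop 0,
    t1.eventually_le_const (show (0 : ℝ) < 1 / 2 by norm_num),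
    t1.eventually_le_const (show (0 : ℝ) < 1 - ε by linarith),
    t2.eventually_le_const (show (0 : ℝ) < δ⁻¹ by positivity),
    t3.eventually_le_const hκ0,
    t4.eventually_le_const (show (0 : ℝ) < 1 / r by positivity),
    hh.eventually_le_const (show (0 : ℝ) < z₀ / 2 by linarith),
    hh.eventually_le_const (show (0 : ℝ) < 1 - z₀ by linarith),
    tendsto_natCast_atTop_atTop.eventually_ge_atTop (4 / z₀)] with
    n hn e1 e2 e3 e4 e5 e6 e7 e8
  have hn' : (0 : ℝ) < n := by exact_mod_cast hn
  have hh0 := bandwidth_pos β hn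
  have hsq := bandwidth_rpow_sq_mul hβ hn
  have hrate := bandwidth_rpow_mul_rate β hn
  set h := bandwidth β n
  set ψ := h ^ β
  have hψ0 : 0 < ψ := Real.rpow_pos_of_pos hh0 β
  set V := plateau hρ0 hρ1'
  set g := perturbation V ψ h z₀ with hg
  have hnz : 2 ≤ n * (z₀ - h) := by
    rw [div_le_iff₀ hz] at e8
    nlinarith
  obtain ⟨hD1, hD2⟩ := sum_sq_coeff_perturbation hρ0 hρ1' hh0 hsq hnz e7
  have hderiv : b * ψ * M / h ≤ δ⁻¹ := by
    refine le_trans (le_of_eq ?_) e3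
    rw [Real.rpow_sub_one hh0.ne']
    ring
  have hgz : g z₀ = ψ := by
    rw [hg, perturbation, sub_self, zero_div, plateau_zero, mul_one]
  have hc0 : coeff n g 0 = 0 := by
    refine coeff_perturbation_eq_zero hρ0 hρ1' hh0 (le_trans ?_ (neg_le_abs _))
    have h1 : (((0 + 1 : ℕ) : ℝ)) / n ≤ z₀ - h := by
      rw [div_le_iff₀ hn']
      push_cast
      linarith
    linarith
  have hcn : coeff n g n = 0 := by
    refine coeff_perturbation_eq_zero hρ0 hρ1' hh0 (le_trans ?_ (le_abs_self _))
    have h1 : 1 ≤ ((n + 1 : ℕ) : ℝ) / n := by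
      rw [le_div_iff₀ hn']
      push_cast
      linarith
    linarith
  refine le_iInf₂ fun T hT => ?_
  refine family_risk_ge y₀ (g := g) (ψ := ψ) (b := b) (r := r) (κ := κ) hc0 hcn
    (fun k => abs_perturbation_le V hψ0.le h z₀ _) rfl (by linarith) (by linarith) hκ0 hr0.le hb0
    (by nlinarith) e1 ?_ (hT.const_mul (rate β n)) fun u hu => ?_
  · refine le_trans ?_ e5
    have hD3 : ∑ k : Fin n, coeff n g (k + 1) ^ 2 ≤ 2 + κ := by linarith
    gcongr
  · have hu' : |u| ≤ b := abs_le.2 hu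
    have hmem : u • g ∈ weakHolderClass β δ n z₀ ε :=
      smul_perturbation_mem hρ0 hρ1' hh0 hM e2 hderiv hρb hu'
    have hval : (u • g) z₀ = u * ψ := by rw [Pi.smul_apply, hgz, smul_eq_mul]
    have hlt : |(u • g) z₀| < 1 :=
      (hmem.1.2 z₀ ⟨hz.le, hz'.le⟩).trans_lt (by linarith)
    exact (scaled_loss_le (isNoiseDensity_gaussian hσ) (Real.rpow_nonneg hn'.le _) hrate hval
      hlt).trans (le_iSup₂_of_le (u • g) hmem le_rfl)

theorem tendsto_lowerBound : Tendsto lowerBound atTop (nhds (√Real.pi)⁻¹) := by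
  have hinv : Tendsto (fun r : ℝ => 1 / r) atTop (nhds 0) := by
    simpa using tendsto_inv_atTop_zero (𝕜 := ℝ)
  have hexp : Tendsto (fun r : ℝ => Real.exp (-r ^ 2 / 2)) atTop (nhds 0) := by
    refine Real.tendsto_exp_atBot.comp ?_
    have h := (tendsto_pow_atTop (α := ℝ) two_ne_zero).atTop_div_const two_pos
    simpa [neg_div, Function.comp_def] using tendsto_neg_atTop_atBot.comp h
  have hκ : Tendsto (fun r : ℝ => 1 / (2 * r)) atTop (nhds 0) :=
    hinv.comp (tendsto_id.const_mul_atTop two_pos)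
  have hK : Tendsto (fun r : ℝ => Real.pi * (2 + 2 * (1 / (2 * r)))) atTop
      (nhds (Real.pi * (2 + 2 * 0))) := ((hκ.const_mul 2).const_add 2).const_mul Real.pi
  have hsqrt : Tendsto (fun r : ℝ => √(2 / (Real.pi * (2 + 2 * (1 / (2 * r)))))) atTop
      (nhds (√(2 / (Real.pi * (2 + 2 * 0))))) :=
    (tendsto_const_nhds.div hK (by have := Real.pi_pos; positivity)).sqrt
  have hfrac : Tendsto (fun r : ℝ => (r ^ 2 - 2 * r) / r ^ 2) atTop (nhds (1 - 2 * 0)) := by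
    refine ((hinv.const_mul 2).const_sub 1).congr' ?_
    filter_upwards [eventually_gt_atTop 0] with r hr
    field_simp
  have h := ((hsqrt.mul (hexp.const_sub 1)).mul
    ((hinv.const_sub 1).sub (hexp.const_mul 2))).mul hfrac
  have hval : √(2 / (Real.pi * (2 + 2 * 0))) * (1 - 0) * (1 - 0 - 2 * 0) * (1 - 2 * 0) =
      (√Real.pi)⁻¹ := by
    rw [← Real.sqrt_inv, show 2 / (Real.pi * (2 + 2 * 0)) = Real.pi⁻¹ by
      have := Real.pi_pos
      field_simp
      norm_num]
    ring
  rw [hval] at h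
  exact h

end AutoReg
end

theorem theorem2p3 (β : ℝ) (hβ₁ : 1 < β) (hβ₂ : β < 2)
    (z₀ : ℝ) (hz₀ : z₀ ∈ Set.Ioo (0 : ℝ) 1) (y₀ : ℝ) (σ : ℝ) (hσ : 3 ≤ σ)
    (δ : ℝ) (hδ : 0 < δ) (ε : ℝ) (hε₀ : 0 < ε) (hε₁ : ε < 1) :
    ENNReal.ofReal (∫ x, |x| ∂(ProbabilityTheory.gaussianReal 0 (1 / 2))) ≤
      Filter.liminf (fun n : ℕ => AutoReg.normalizedMinimaxRisk β δ y₀ σ z₀ ε n)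
        Filter.atTop := by
  rw [AutoReg.integral_abs_gaussianReal_half]
  refine le_of_tendsto (ENNReal.tendsto_ofReal AutoReg.tendsto_lowerBound) ?_
  filter_upwards [eventually_ge_atTop 2] with r hr
  exact le_liminf_of_le (by isBoundedDefault)
    (AutoReg.eventually_lowerBound_le hβ₁ hz₀ y₀ hσ hδ hε₀ hε₁ hr)
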